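/- Let $K\subset\mathbb{R}^d$ be compact and let $\Phi=\{\phi_i\}_{i\in\mathcal{D}}$ be a finite family of contractions $\phi_i:K\to K$ that is a conformal iterated function system: each $\phi_i$ extends to an injective $C^1$ contraction (again denoted $\phi_i$) from an open connected set $V\supset K$ into $\mathbb{R}^d$ such that $|\phi_i'(x)y|=|\phi_i'(x)|\,|y|$ for all $x\in V$, $y\in\mathbb{R}^d$; such that $0<\inf_{x\in V}|\phi_i'(x)|\le\sup_{x\in V}|\phi_i'(x)|<1$; and such that, for some $\alpha,c>0$, $\big||\phi_i'(x)|-|\phi_i'(y)|\big|\le c|x-y|^{\alpha}$ for all $x,y\in V$. (The set $V$ may depend on $i$.) Let $X\subset K$ be the attractor of $\Phi$, that is, the unique non-empty compact subset of $K$ with $X=\bigcup_{i\in\mathcal{D}}\phi_i(X)$, and suppose that $\Phi$ satisfies the strong separation condition: $\phi_i(X)\cap\phi_j(X)=\emptyset$ for all $i\ne j$. For a finite word $I=(i_1,\dots,i_n)\in\mathcal{D}^n$ write $|I|=n$, $\phi_I=\phi_{i_1}\circ\cdots\circ\phi_{i_n}$ and $X_I=\phi_I(X)$; let $\mathcal{D}^*=\bigcup_{n\ge1}\mathcal{D}^n$.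 For $z\in X$ and $\theta:\mathbb{N}\to\mathbb{R}_{\ge0}$, where $\mathbb{N}=\{1,2,\dots\}$, let $$W(\theta,z)=\big\{x\in X:\ x\in B\big(\phi_I(z),\operatorname{Diam}(X_I)\,\theta(|I|)\big)\text{ for infinitely many } I\in\mathcal{D}^*\big\},$$ where $B(y,r)$ is the open ball with centre $y$ and radius $r$. A coding of $z\in X$ is a sequence $(z_i)_{i\ge1}\in\mathcal{D}^{\mathbb{N}}$ with $z\in X_{(z_1,\dots,z_n)}$ for all $n$. The point $z$ has a leading block coding if it has a coding $(z_i)$ for which there is $l\ge1$ such that the initial word $(z_1,\dots,z_l)$ appears only finitely many times in $(z_i)$, i.e. $(z_{k+1},\dots,z_{k+l})=(z_1,\dots,z_l)$ for only finitely many $k\ge0$. Let $Y\subset X$ be the set of points of $X$ that have a leading block coding. Then $\dim_H(Y)=\dim_H(X)$, and for every $z\in Y$ and every function $\theta:\mathbb{N}\to\mathbb{R}_{\ge0}$ (not assumed to be monotone) with $$\sum_{n=1}^{\infty}\sum_{I\in\mathcal{D}^n}\big(\operatorname{Diam}(X_I)\,\theta(n)\big)^{\dim_H(X)}=\infty,$$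 $\mathcal{H}^{\dim_H(X)}$-almost every $x\in X$ belongs to $W(\theta,z)$. -/

import Mathlib

open MeasureTheory Set
open scoped NNReal ENNReal

namespace ConformalIFS

variable {ι E : Type*}

/-- The composition `φ_I = φ_{i_1} ∘ ⋯ ∘ φ_{i_n}` attached to a finite word `I = [i_1, …, i_n]`. -/
def wordMap (φ : ι → E → E) : List ι → E → E
  | [] => id
  | i :: I => φ i ∘ wordMap φ I

/-- The cylinder set `X_I = φ_I(X)`. -/
def cylinder (φ : ι → E → E) (X : Set E) (I : List ι) : Set E :=
  wordMap φ I '' X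

/-- An iterated function system on the closed set `K`: every `φ i` (only its values on `K` matter)
maps `K` to itself and is a contraction there. -/
structure IsIFS [PseudoEMetricSpace E] (φ : ι → E → E) (K : Set E) : Prop where
  isClosed : IsClosed K
  mapsTo : ∀ i, MapsTo (φ i) K K
  contracting : ∀ i, ∃ r : ℝ≥0, r < 1 ∧ LipschitzOnWith r (φ i) K

/-- `X` is the attractor of the iterated function system `φ` on `K`: the unique non-empty compact
subset of `K` with `X = ⋃ i, φ_i(X)`. -/
structure IsAttractor [TopologicalSpace E] (φ : ι → E → E) (K X : Set E) : Prop where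
  subset : X ⊆ K
  nonempty : X.Nonempty
  isCompact : IsCompact X
  eq_iUnion : X = ⋃ i, φ i '' X

/-- `f` is a conformal mapping on the open set `V`: it is `C¹` and its differential at each point
of `V` satisfies `|f'(x) y| = |f'(x)| |y|`. -/
structure IsConformalOn [NormedAddCommGroup E] [NormedSpace ℝ E] (f : E → E) (V : Set E) :
    Prop where
  contDiffOn : ContDiffOn ℝ 1 f V
  norm_fderiv_apply : ∀ x ∈ V, ∀ y : E, ‖fderiv ℝ f x y‖ = ‖fderiv ℝ f x‖ * ‖y‖

/-- A conformal iterated function system on the compact set `K`: an iterated function system on `K`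
each of whose maps extends to an injective conformal contraction `f` of an open connected
neighbourhood `V` of `K`, with `0 < inf_V |f'| ≤ sup_V |f'| < 1` and with `|f'|` Hölder continuous
on `V`. -/
structure IsConformalIFS [NormedAddCommGroup E] [NormedSpace ℝ E] (φ : ι → E → E) (K : Set E) :
    Prop where
  isCompact : IsCompact K
  isIFS : IsIFS φ K
  extension : ∀ i, ∃ (V : Set E) (f : E → E),
    IsOpen V ∧ IsConnected V ∧ K ⊆ V ∧ EqOn f (φ i) K ∧
    InjOn f V ∧ IsConformalOn f V ∧
    (∃ r : ℝ≥0, r < 1 ∧ LipschitzOnWith r f V) ∧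
    (∃ a : ℝ, 0 < a ∧ ∀ x ∈ V, a ≤ ‖fderiv ℝ f x‖) ∧
    (∃ b : ℝ, b < 1 ∧ ∀ x ∈ V, ‖fderiv ℝ f x‖ ≤ b) ∧
    (∃ α c : ℝ, 0 < α ∧ 0 < c ∧ ∀ x ∈ V, ∀ y ∈ V,
      |‖fderiv ℝ f x‖ - ‖fderiv ℝ f y‖| ≤ c * ‖x - y‖ ^ α)

/-- The strong separation condition. -/
def StrongSeparation (φ : ι → E → E) (X : Set E) : Prop :=
  ∀ i j, i ≠ j → Disjoint (φ i '' X) (φ j '' X)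

/-- The sequence `a` (written `a 0, a 1, …`) is a coding of `z`: the point `z` lies in all the
cylinders `X_{a_0, …, a_{n-1}}`. -/
def IsCoding (φ : ι → E → E) (X : Set E) (a : ℕ → ι) (z : E) : Prop :=
  ∀ n : ℕ, z ∈ cylinder φ X (List.ofFn fun k : Fin n => a k)

/-- `z` has a leading block coding: it has a coding one of whose initial words `a_0, …, a_{l-1}`
(`l ≥ 1`) appears in it at finitely many places `k` only. -/
def HasLeadingBlockCoding (φ : ι → E → E) (X : Set E) (z : E) : Prop :=
  ∃ a : ℕ → ι, IsCoding φ X a z ∧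
    ∃ l : ℕ, 1 ≤ l ∧ {k : ℕ | ∀ j < l, a (k + j) = a j}.Finite

/-- The limsup set `W(Ψ, z)`: the points of `X` in the balls `B(φ_I(z), Ψ(I))` for infinitely many
non-empty finite words `I`. -/
def limsupSet [PseudoMetricSpace E] (φ : ι → E → E) (X : Set E) (Ψ : List ι → ℝ) (z : E) : Set E :=
  {x ∈ X | {I : List ι | I ≠ [] ∧ x ∈ Metric.ball (wordMap φ I z) (Ψ I)}.Infinite}

/-- The set `W(θ, z) = W(Diam(X_I) θ(|I|), z)`. -/
noncomputable def approxSet [PseudoMetricSpace E] (φ : ι → E → E) (X : Set E) (θ : ℕ → ℝ≥0)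
    (z : E) : Set E :=
  limsupSet φ X (fun I => Metric.diam (cylinder φ X I) * θ I.length) z

/-- The divergence condition
`∑_{n ≥ 1} ∑_{I ∈ D^n} (Diam(X_I) θ(n)) ^ dim_H(X) = ∞`; the summation index below is `n - 1`. -/
def DivergenceCondition [Fintype ι] [MetricSpace E] (φ : ι → E → E) (X : Set E)
    (θ : ℕ → ℝ≥0) : Prop :=
  ∑' n : ℕ, ∑ I : Fin (n + 1) → ι,
    ENNReal.ofReal
      ((Metric.diam (cylinder φ X (List.ofFn I)) * θ (n + 1)) ^ (dimH X).toReal) = ∞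

end ConformalIFS

/-! Write `s` for the dimension of `X` and `μ` for the `s`-dimensional Hausdorff measure on `X`.
Bounded distortion makes `φ_I` scale distances in `X` by `Diam(X_I)` up to a constant
(`exists_isQuasiSimilar`). Everything later uses only this, strong separation and the finiteness of
the alphabet. It follows that `μ(X_I)` is comparable to `Diam(X_I)^s` (`exists_measure_cylinder`),
so that `μ` is multiplicative on concatenated words up to a constant (`exists_isQuasiBernoulli`).

If the code of `x` is a word `I` of length `n` followed by the first `k` letters of `z`, then `x`
and `φ_I(z)` both lie in `φ_I(X_{z_1…z_k})`, hence at distance at most `C Diam(X_I)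
Diam(X_{z_1…z_k})`. Choosing `k = k(n)` so that the last diameter times `C` is just below `θ(n)`
reduces the claim to a statement about codes: almost every code shows the first `k(n)` letters of
`z` at place `n` for infinitely many `n`. The measures of these events have a divergent sum, because
the level sums of `Diam(X_I)^s` are bounded (`sum_cdiam_rpow_le`, `not_summable_of_divergence`).

The leading block condition makes the events quasi-independent (`measureReal_inter_le`). If
occurrences at `n < m` overlapped in at least `l` letters, the first `l` letters of `z` would
reappear in `z` at place `m - n`, which is impossible once `m - n` exceeds some `L`. Shorter
overlaps cost a bounded factor. No relation between `k(n)` and `k(m)` enters, so `θ` need not be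
monotone. A second moment bound inside each cylinder (`exists_proportion`) then gives the events a
fixed proportion of every cylinder, and a set missing such a proportion everywhere is null
(`measure_eq_zero_of_separated`).

For the dimension of `Y`, fix a letter `i₀` and a block length `n`. A word of `2n` letters `i₀`
followed by blocks other than `i₀^n` is a leading block coding (`hasLeadingBlockCoding`). For large
`n`, discarding one block costs arbitrarily little dimension (`exists_blocks`, `le_dimH_blockSet`).
-/

namespace ConformalIFS

open Filter Topology Metric

/-! ### Distortion of a single conformal map. -/

section Calculus

variable {E : Type*} [NormedAddCommGroup E] [NormedSpace ℝ E]

/-- A local inverse of an injective map with invertible strict derivative. -/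
lemma hasFDerivAt_invFunOn [CompleteSpace E] [Nonempty E] {f : E → E} {V : Set E} (hV : IsOpen V)
    (hf : InjOn f V) {x : E} (hx : x ∈ V) {A : E ≃L[ℝ] E}
    (hA : HasStrictFDerivAt f (A : E →L[ℝ] E) x) :
    f '' V ∈ 𝓝 (f x) ∧
      HasFDerivAt (Function.invFunOn f V) (A.symm : E →L[ℝ] E) (f x) := by
  have hmap := hA.map_nhds_eq_of_equiv
  have himg : ∀ N ∈ 𝓝 x, f '' N ∈ 𝓝 (f x) := fun N hN => by
    rw [← hmap]; exact image_mem_map hN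
  have hVn := hV.mem_nhds hx
  have hgx : Function.invFunOn f V (f x) = x := hf.leftInvOn_invFunOn hx
  refine ⟨himg V hVn, ?_⟩
  refine HasFDerivAt.of_local_left_inverse (f := f) ?_ (by rw [hgx]; exact hA.hasFDerivAt) ?_
  -- The inverse is continuous at `f x` because `f` maps neighbourhoods of `x` to neighbourhoods of
  -- `f x`.
  · rw [ContinuousAt, hgx]
    intro N hN
    refine mem_map.2 (mem_of_superset (himg (N ∩ V) (inter_mem hN hVn)) ?_)
    rintro _ ⟨y, ⟨hyN, hyV⟩, rfl⟩
    rw [mem_preimage, hf.leftInvOn_invFunOn hyV]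
    exact hyN
  · filter_upwards [himg V hVn] with y hy
    exact Function.invFunOn_eq hy

/-- A linear map scaling all norms by a positive factor is invertible, and its inverse scales by
the inverse factor. -/
lemma exists_equiv_of_norm_apply [FiniteDimensional ℝ E] (A : E →L[ℝ] E) {a : ℝ} (ha : 0 < a)
    (h : ∀ y, ‖A y‖ = a * ‖y‖) :
    ∃ B : E ≃L[ℝ] E, (B : E →L[ℝ] E) = A ∧ ‖(B.symm : E →L[ℝ] E)‖ ≤ a⁻¹ := by
  have hinj : Function.Injective A := by
    intro y y' hy
    have := h (y - y')
    rw [map_sub, hy, sub_self, norm_zero] at this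
    rcases mul_eq_zero.1 this.symm with h0 | h0
    · exact absurd h0 ha.ne'
    · exact sub_eq_zero.1 (norm_eq_zero.1 h0)
  let e : E ≃ₗ[ℝ] E := LinearEquiv.ofInjectiveEndo (A : E →ₗ[ℝ] E) hinj
  refine ⟨e.toContinuousLinearEquiv, ?_, ?_⟩
  · ext y; rfl
  · refine ContinuousLinearMap.opNorm_le_bound _ (by positivity) fun y => ?_
    have h1 : A (e.symm y) = y := e.apply_symm_apply y
    have h2 := h (e.symm y)
    rw [h1] at h2
    change ‖e.symm y‖ ≤ _
    rw [h2, ← mul_assoc, inv_mul_cancel₀ ha.ne', one_mul]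

/-- The distortion estimate for one map on a set: the map `f` scales the distance of `x` and `y`
by `L x`, up to the factor `exp (C |x - y| ^ α)`, and `L` itself varies by such a factor only. -/
structure HasDistortion {E : Type*} [PseudoMetricSpace E] (f : E → E) (K : Set E) (L : E → ℝ)
    (C α : ℝ) : Prop where
  pos : ∀ x ∈ K, 0 < L x
  upper : ∀ x ∈ K, ∀ y ∈ K, dist (f x) (f y) ≤ Real.exp (C * dist x y ^ α) * (L x * dist x y)
  lower : ∀ x ∈ K, ∀ y ∈ K, L x * dist x y ≤ Real.exp (C * dist x y ^ α) * dist (f x) (f y)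
  holder : ∀ x ∈ K, ∀ y ∈ K, L x ≤ Real.exp (C * dist x y ^ α) * L y

/-- Division by `L y ≥ a` and `1 + t ≤ exp t` turn additive Hölder continuity into a multiplicative
bound, the form that accumulates well along compositions. -/
lemma holder_exp {E : Type*} [PseudoMetricSpace E] {V : Set E} {L : E → ℝ} {a c α : ℝ} (ha : 0 < a) (hL : ∀ x ∈ V, a ≤ L x)
    (hc : 0 < c) (h : ∀ x ∈ V, ∀ y ∈ V, |L x - L y| ≤ c * dist x y ^ α) :
    ∀ x ∈ V, ∀ y ∈ V, L x ≤ Real.exp (c / a * dist x y ^ α) * L y := by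
  intro x hx y hy
  have h1 := (le_abs_self _).trans (h x hx y hy)
  have h2 := Real.add_one_le_exp (c / a * dist x y ^ α)
  have h3 := hL y hy
  have h4 : (0:ℝ) ≤ dist x y ^ α := by positivity
  calc L x ≤ c * dist x y ^ α + L y := by linarith
    _ = c / a * dist x y ^ α * a + L y := by field_simp
    _ ≤ c / a * dist x y ^ α * L y + L y := by gcongr
    _ = (c / a * dist x y ^ α + 1) * L y := by ring
    _ ≤ _ := by
      have : 0 < L y := ha.trans_le h3
      gcongr

/-- The upper distortion bound at small scales. -/
lemma local_upper {f : E → E} {K V : Set E} (hV : IsOpen V) (hK : IsCompact K) (hKV : K ⊆ V)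
    (hd : ∀ x ∈ V, DifferentiableAt ℝ f x) {C α : ℝ} (hC : 0 ≤ C) (hα : 0 < α)
    (h : ∀ x ∈ V, ∀ y ∈ V, ‖fderiv ℝ f x‖ ≤ Real.exp (C * dist x y ^ α) * ‖fderiv ℝ f y‖) :
    ∃ δ > 0, ∀ x ∈ K, ∀ y ∈ K, dist x y < δ →
      dist (f x) (f y) ≤ Real.exp (C * dist x y ^ α) * (‖fderiv ℝ f x‖ * dist x y) := by
  obtain ⟨δ, hδ, hsub⟩ := hK.exists_thickening_subset_open hV hKV
  refine ⟨δ, hδ, fun x hx y hy hxy => ?_⟩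
  have hball : closedBall x (dist x y) ⊆ V := fun w hw =>
    hsub (mem_thickening_iff.2 ⟨x, hx, (mem_closedBall.1 hw).trans_lt hxy⟩)
  -- `V` need not be convex, so the mean value inequality is used on a ball inside `V`; this is why
  -- the bound is local.
  have := (convex_closedBall x (dist x y)).norm_image_sub_le_of_norm_fderiv_le (𝕜 := ℝ) (f := f)
    (C := Real.exp (C * dist x y ^ α) * ‖fderiv ℝ f x‖) (fun w hw => hd w (hball hw))
    (fun w hw => ?_) (mem_closedBall.2 (by rw [dist_comm])) (mem_closedBall_self dist_nonneg)
      (x := y) (y := x)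
  · rw [← dist_eq_norm, ← dist_eq_norm] at this
    linarith
  · refine (h w (hball hw) x (hKV hx)).trans ?_
    have := mem_closedBall.1 hw
    gcongr

/-- The lower distortion bound at small scales. -/
lemma local_lower [FiniteDimensional ℝ E] {f : E → E} {K V : Set E} (hV : IsOpen V)
    (hK : IsCompact K) (hKV : K ⊆ V) (hf : InjOn f V) (hconf : IsConformalOn f V)
    (hlip : ∀ x ∈ K, ∀ y ∈ K, dist (f x) (f y) ≤ dist x y)
    {a : ℝ} (ha : 0 < a) (haV : ∀ x ∈ V, a ≤ ‖fderiv ℝ f x‖) {C α : ℝ} (hC : 0 ≤ C) (hα : 0 < α)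
    (h : ∀ x ∈ V, ∀ y ∈ V, ‖fderiv ℝ f x‖ ≤ Real.exp (C * dist x y ^ α) * ‖fderiv ℝ f y‖) :
    ∃ δ > 0, ∀ x ∈ K, ∀ y ∈ K, dist x y < δ →
      ‖fderiv ℝ f x‖ * dist x y ≤
        Real.exp (C * a⁻¹ ^ α * dist x y ^ α) * dist (f x) (f y) := by
  have hcomplete := FiniteDimensional.complete ℝ E
  -- The lower bound for `f` is the mean value inequality for its inverse `g`. Conformality enters
  -- here: the norm of the inverse derivative is at most the inverse of the norm.
  set g := Function.invFunOn f V with hg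
  have hgf : ∀ x ∈ V, g (f x) = x := fun x hx => hf.leftInvOn_invFunOn hx
  have key : ∀ x ∈ V, f '' V ∈ 𝓝 (f x) ∧ DifferentiableAt ℝ g (f x) ∧
      ‖fderiv ℝ g (f x)‖ ≤ ‖fderiv ℝ f x‖⁻¹ := by
    intro x hx
    obtain ⟨B, hB, hBn⟩ := exists_equiv_of_norm_apply (fderiv ℝ f x) (ha.trans_le (haV x hx))
      (hconf.norm_fderiv_apply x hx)
    have hs : HasStrictFDerivAt f (fderiv ℝ f x) x :=
      ((hconf.contDiffOn.contDiffAt (hV.mem_nhds hx)).hasStrictFDerivAt (by simp))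
    rw [← hB] at hs
    obtain ⟨h1, h2⟩ := hasFDerivAt_invFunOn hV hf hx hs
    exact ⟨h1, h2.differentiableAt, by rw [h2.fderiv]; exact hBn⟩
  have hopen : IsOpen (f '' V) := by
    rw [isOpen_iff_mem_nhds]
    rintro _ ⟨x, hx, rfl⟩
    exact (key x hx).1
  have hcont : ContinuousOn f K := hconf.contDiffOn.continuousOn.mono hKV
  obtain ⟨η, hη, hsub⟩ := (hK.image_of_continuousOn hcont).exists_thickening_subset_open hopen
    (image_mono hKV)
  refine ⟨η, hη, fun x hx y hy hxy => ?_⟩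
  set R := dist (f x) (f y) with hR
  have hRxy : R ≤ dist x y := hlip x hx y hy
  have hball : closedBall (f x) R ⊆ f '' V := fun w hw =>
    hsub (mem_thickening_iff.2 ⟨f x, mem_image_of_mem f hx,
      (mem_closedBall.1 hw).trans_lt (hRxy.trans_lt hxy)⟩)
  have hdiff : ∀ w ∈ closedBall (f x) R, DifferentiableAt ℝ g w := fun w hw => by
    obtain ⟨v, hv, rfl⟩ := hball hw
    exact (key v hv).2.1
  have hxR : f x ∈ closedBall (f x) R := mem_closedBall_self dist_nonneg
  have hyR : f y ∈ closedBall (f x) R := mem_closedBall.2 (by rw [dist_comm])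
  have hLx : 0 < ‖fderiv ℝ f x‖ := ha.trans_le (haV x (hKV hx))
  have hbound : ∀ w ∈ closedBall (f x) R, ‖fderiv ℝ g w‖ ≤
      Real.exp (C * a⁻¹ ^ α * dist x y ^ α) * ‖fderiv ℝ f x‖⁻¹ := by
    intro w hw
    -- A first, crude application with constant `a⁻¹` places the preimage `v` of `w` within `a⁻¹ *
    -- dist x y` of `x`; hence the factor `a⁻¹ ^ α` in the exponent.
    have h1 := (convex_closedBall (f x) R).norm_image_sub_le_of_norm_fderiv_le (𝕜 := ℝ)
      (f := g) (C := a⁻¹) hdiff (fun u hu => by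
        obtain ⟨v, hv, rfl⟩ := hball hu
        refine (key v hv).2.2.trans ?_
        have := haV v hv
        gcongr) hxR hw
    obtain ⟨v, hv, rfl⟩ := hball hw
    rw [hgf v hv, hgf x (hKV hx), ← dist_eq_norm, ← dist_eq_norm] at h1
    refine (key v hv).2.2.trans ?_
    have hLv : 0 < ‖fderiv ℝ f v‖ := ha.trans_le (haV v hv)
    have h2 := h x (hKV hx) v hv
    have h3 : dist x v ≤ a⁻¹ * dist x y := by
      rw [dist_comm x v]
      refine h1.trans ?_
      have := (mem_closedBall.1 hw).trans hRxy
      gcongr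
    have h4 : C * dist x v ^ α ≤ C * a⁻¹ ^ α * dist x y ^ α := by
      rw [mul_assoc, ← Real.mul_rpow (by positivity) dist_nonneg]
      gcongr
    have h5 : ‖fderiv ℝ f x‖ ≤ Real.exp (C * a⁻¹ ^ α * dist x y ^ α) * ‖fderiv ℝ f v‖ :=
      h2.trans (by gcongr)
    rw [inv_le_iff_one_le_mul₀ hLv, mul_right_comm, ← div_eq_mul_inv, le_div_iff₀ hLx]
    simpa using h5
  have h1 := (convex_closedBall (f x) R).norm_image_sub_le_of_norm_fderiv_le (𝕜 := ℝ)
      (f := g) hdiff hbound hyR hxR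
  rw [hgf x (hKV hx), hgf y (hKV hy), ← dist_eq_norm, ← dist_eq_norm, ← hR] at h1
  calc ‖fderiv ℝ f x‖ * dist x y
      ≤ ‖fderiv ℝ f x‖ * (Real.exp (C * a⁻¹ ^ α * dist x y ^ α) * ‖fderiv ℝ f x‖⁻¹ * R) := by
        gcongr
    _ = _ := by field_simp

/-- A conformal contraction on a neighbourhood of a compact set has the distortion property on
that set. -/
lemma exists_hasDistortion [FiniteDimensional ℝ E] {f : E → E} {K V : Set E} (hV : IsOpen V)
    (hK : IsCompact K) (hKV : K ⊆ V) (hf : InjOn f V) (hconf : IsConformalOn f V)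
    (hlip : ∀ x ∈ K, ∀ y ∈ K, dist (f x) (f y) ≤ dist x y)
    {a : ℝ} (ha : 0 < a) (haV : ∀ x ∈ V, a ≤ ‖fderiv ℝ f x‖)
    (h1V : ∀ x ∈ V, ‖fderiv ℝ f x‖ ≤ 1) {c α : ℝ} (hc : 0 < c) (hα : 0 < α)
    (h : ∀ x ∈ V, ∀ y ∈ V, |‖fderiv ℝ f x‖ - ‖fderiv ℝ f y‖| ≤ c * ‖x - y‖ ^ α) :
    ∃ C, 0 ≤ C ∧ HasDistortion f K (fun x => ‖fderiv ℝ f x‖) C α := by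
  have hhol := holder_exp ha haV hc (by simpa only [dist_eq_norm] using h)
  have hC0 : 0 ≤ c / a := by positivity
  obtain ⟨δ₁, hδ₁, hup⟩ := local_upper hV hK hKV (fun x hx =>
    (hconf.contDiffOn.contDiffAt (hV.mem_nhds hx)).differentiableAt (by simp)) hC0 hα hhol
  obtain ⟨δ₂, hδ₂, hlo⟩ := local_lower hV hK hKV hf hconf hlip ha haV hC0 hα hhol
  set δ := min δ₁ δ₂ with hδdef
  have hδ : 0 < δ := lt_min hδ₁ hδ₂
  have hcont : ContinuousOn f K := hconf.contDiffOn.continuousOn.mono hKV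
  -- Points far apart are handled by compactness and injectivity.
  obtain ⟨m, hm, hfar⟩ : ∃ m > 0, ∀ x ∈ K, ∀ y ∈ K, δ ≤ dist x y → m ≤ dist (f x) (f y) := by
    set S : Set (E × E) := (K ×ˢ K) ∩ {p | δ ≤ dist p.1 p.2} with hS
    have hScomp : IsCompact S := (hK.prod hK).inter_right
      (isClosed_le continuous_const (continuous_fst.dist continuous_snd))
    have hcS : ContinuousOn (fun p : E × E => dist (f p.1) (f p.2)) S :=
      continuous_dist.comp_continuousOn
        ((ContinuousOn.comp (t := K) hcont continuousOn_fst fun p hp => hp.1.1).prodMk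
          (ContinuousOn.comp (t := K) hcont continuousOn_snd fun p hp => hp.1.2))
    rcases S.eq_empty_or_nonempty with h0 | hne
    · refine ⟨1, one_pos, fun x hx y hy hxy => ?_⟩
      have : (x, y) ∈ S := ⟨⟨hx, hy⟩, hxy⟩
      simp [h0] at this
    · obtain ⟨p, hp, hmin⟩ := hScomp.exists_isMinOn hne hcS
      refine ⟨dist (f p.1) (f p.2), ?_, fun x hx y hy hxy => hmin (a := (x, y)) ⟨⟨hx, hy⟩, hxy⟩⟩
      refine dist_pos.2 fun heq => ?_
      have := hf (hKV hp.1.1) (hKV hp.1.2) heq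
      have h2 : δ ≤ dist p.1 p.2 := hp.2
      rw [this, dist_self] at h2
      linarith
  obtain ⟨D, hD⟩ := Metric.isBounded_iff.1 hK.isBounded
  have hδα : 0 < δ ^ α := Real.rpow_pos_of_pos hδ α
  -- At distances at least `δ` a factor `b` is dominated by `exp ((b / δ ^ α) * dist x y ^ α)`. Here
  -- `b` is `a⁻¹` for the upper bound and `|D| / m` for the lower one.
  set C₃ := a⁻¹ / δ ^ α with hC₃
  set C₄ := (|D| / m) / δ ^ α with hC₄
  have hC₃' : 0 ≤ C₃ := by positivity
  have hC₄' : 0 ≤ C₄ := by positivity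
  set C := c / a + c / a * a⁻¹ ^ α + C₃ + C₄ with hC
  have hca : 0 ≤ c / a * a⁻¹ ^ α := by positivity
  have hexp : ∀ x y C', 0 ≤ C' → C' ≤ C →
      Real.exp (C' * dist (x : E) y ^ α) ≤ Real.exp (C * dist x y ^ α) := by
    intro x y C' _ hC'
    gcongr
  have hexp' : ∀ (x y : E) (b : ℝ), 0 ≤ b → δ ≤ dist x y →
      b ≤ Real.exp (b / δ ^ α * dist x y ^ α) := by
    intro x y b hb hxy
    have h1 : δ ^ α ≤ dist x y ^ α := by gcongr
    have h2 : b ≤ b / δ ^ α * dist x y ^ α := by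
      rw [div_mul_eq_mul_div, le_div_iff₀ hδα]
      gcongr
    linarith [Real.add_one_le_exp (b / δ ^ α * dist x y ^ α)]
  refine ⟨C, by positivity, fun x hx => ha.trans_le (haV x (hKV hx)), ?_, ?_, ?_⟩
  · intro x hx y hy
    have hL := haV x (hKV hx)
    rcases lt_or_ge (dist x y) δ with hxy | hxy
    · refine (hup x hx y hy (hxy.trans_le (min_le_left _ _))).trans ?_
      have := hexp x y (c / a) hC0 (by rw [hC]; linarith)
      gcongr
    · have h1 := hexp' x y a⁻¹ (by positivity) hxy
      have h2 := hexp x y C₃ hC₃' (by rw [hC]; linarith)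
      calc dist (f x) (f y) ≤ dist x y := hlip x hx y hy
        _ = a⁻¹ * (a * dist x y) := by field_simp
        _ ≤ Real.exp (C * dist x y ^ α) * (‖fderiv ℝ f x‖ * dist x y) := by
          gcongr
          exact h1.trans h2
  · intro x hx y hy
    rcases lt_or_ge (dist x y) δ with hxy | hxy
    · refine (hlo x hx y hy (hxy.trans_le (min_le_right _ _))).trans ?_
      have := hexp x y (c / a * a⁻¹ ^ α) hca (by rw [hC]; linarith)
      gcongr
    · have h1 := hexp' x y (|D| / m) (by positivity) hxy
      have h2 := hexp x y C₄ hC₄' (by rw [hC]; linarith)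
      calc ‖fderiv ℝ f x‖ * dist x y ≤ 1 * |D| := by
            gcongr
            · exact h1V x (hKV hx)
            · exact (hD hx hy).trans (le_abs_self D)
        _ = |D| / m * m := by field_simp
        _ ≤ Real.exp (C * dist x y ^ α) * dist (f x) (f y) := by
          gcongr
          · exact h1.trans h2
          · exact hfar x hx y hy hxy
  · intro x hx y hy
    refine (hhol x (hKV hx) y (hKV hy)).trans ?_
    have := hexp x y (c / a) hC0 (by rw [hC]; linarith)
    gcongr

end Calculus

/-! ### Bounded distortion for words and quasi-similarity. -/

section Distortion

variable {ι E : Type*}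

lemma wordMap_append (φ : ι → E → E) (I J : List ι) :
    wordMap φ (I ++ J) = wordMap φ I ∘ wordMap φ J := by
  induction I with
  | nil => rfl
  | cons i I ih => simp [wordMap, ih, Function.comp_assoc]

lemma wordMap_mapsTo {φ : ι → E → E} {K : Set E} (h : ∀ i, MapsTo (φ i) K K) (I : List ι) :
    MapsTo (wordMap φ I) K K := by
  induction I with
  | nil => exact mapsTo_id K
  | cons i I ih => exact (h i).comp ih

lemma HasDistortion.congr [PseudoMetricSpace E] {f g : E → E} {K : Set E} {L : E → ℝ} {C α : ℝ}
    (h : HasDistortion f K L C α) (hfg : EqOn f g K) : HasDistortion g K L C α where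
  pos := h.pos
  upper x hx y hy := by rw [← hfg hx, ← hfg hy]; exact h.upper x hx y hy
  lower x hx y hy := by rw [← hfg hx, ← hfg hy]; exact h.lower x hx y hy
  holder := h.holder

/-- Bounded distortion for all compositions of maps with the distortion property. -/
lemma exists_wordMap_distortion [PseudoMetricSpace E] {φ : ι → E → E} {K : Set E}
    {L : ι → E → ℝ} {C α : ι → ℝ} (hmaps : ∀ i, MapsTo (φ i) K K)
    (hd : ∀ i, HasDistortion (φ i) K (L i) (C i) (α i)) {ρ : ℝ}
    (hρ : ∀ i, ∀ x ∈ K, ∀ y ∈ K, dist (φ i x) (φ i y) ≤ ρ * dist x y) {H : ℝ → ℝ}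
    (hHmono : ∀ r r', 0 ≤ r → r ≤ r' → H r ≤ H r') (hH0 : ∀ r, 0 ≤ r → 0 ≤ H r)
    (hH : ∀ i r, 0 ≤ r → C i * r ^ α i + H (ρ * r) ≤ H r) (I : List ι) :
    ∃ Λ : E → ℝ, (∀ x ∈ K, 0 < Λ x) ∧
      ∀ x ∈ K, ∀ y ∈ K,
        dist (wordMap φ I x) (wordMap φ I y) ≤ Real.exp (H (dist x y)) * (Λ x * dist x y) ∧
        Λ x * dist x y ≤ Real.exp (H (dist x y)) * dist (wordMap φ I x) (wordMap φ I y) ∧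
        Λ x ≤ Real.exp (H (dist x y)) * Λ y := by
  -- The last letter acts first and brings the points closer by the factor `ρ`, so the induction
  -- closes through `C i * r ^ α i + H (ρ * r) ≤ H r`.
  induction I using List.reverseRecOn with
  | nil =>
    refine ⟨fun _ => 1, fun _ _ => one_pos, fun x _ y _ => ?_⟩
    have h1 : 1 ≤ Real.exp (H (dist x y)) := Real.one_le_exp (hH0 _ dist_nonneg)
    have h2 : dist x y ≤ Real.exp (H (dist x y)) * dist x y := le_mul_of_one_le_left dist_nonneg h1
    refine ⟨?_, ?_, by simpa using h1⟩ <;> simpa [wordMap] using h2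
  | append_singleton I i ih =>
    obtain ⟨Λ, hΛ, h⟩ := ih
    refine ⟨fun x => Λ (φ i x) * L i x, fun x hx =>
      mul_pos (hΛ _ (hmaps i hx)) ((hd i).pos x hx), fun x hx y hy => ?_⟩
    have hw : ∀ z, wordMap φ (I ++ [i]) z = wordMap φ I (φ i z) := fun z => by
      rw [wordMap_append]; rfl
    obtain ⟨h1, h2, h3⟩ := h _ (hmaps i hx) _ (hmaps i hy)
    have hr := hρ i x hx y hy
    have hexp : Real.exp (C i * dist x y ^ α i) * Real.exp (H (dist (φ i x) (φ i y))) ≤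
        Real.exp (H (dist x y)) := by
      rw [← Real.exp_add]
      have := hHmono _ _ dist_nonneg hr
      have := hH i _ (dist_nonneg (x := x) (y := y))
      gcongr
      linarith
    have p1 := hΛ _ (hmaps i hx)
    have p2 := hΛ _ (hmaps i hy)
    have p3 := (hd i).pos x hx
    have p4 := (hd i).pos y hy
    simp only [hw]
    set e1 := Real.exp (H (dist (φ i x) (φ i y)))
    set e2 := Real.exp (C i * dist x y ^ α i)
    set e := Real.exp (H (dist x y))
    have he1 : 0 < e1 := Real.exp_pos _
    have he2 : 0 < e2 := Real.exp_pos _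
    refine ⟨?_, ?_, ?_⟩
    · calc dist (wordMap φ I (φ i x)) (wordMap φ I (φ i y))
          ≤ e1 * (Λ (φ i x) * dist (φ i x) (φ i y)) := h1
        _ ≤ e1 * (Λ (φ i x) * (e2 * (L i x * dist x y))) := by
          gcongr; exact (hd i).upper x hx y hy
        _ = e2 * e1 * (Λ (φ i x) * L i x * dist x y) := by ring
        _ ≤ _ := by gcongr
    · calc Λ (φ i x) * L i x * dist x y = Λ (φ i x) * (L i x * dist x y) := by ring
        _ ≤ Λ (φ i x) * (e2 * dist (φ i x) (φ i y)) :=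
          mul_le_mul_of_nonneg_left ((hd i).lower x hx y hy) p1.le
        _ = e2 * (Λ (φ i x) * dist (φ i x) (φ i y)) := by ring
        _ ≤ e2 * (e1 * dist (wordMap φ I (φ i x)) (wordMap φ I (φ i y))) := by gcongr
        _ = e2 * e1 * dist (wordMap φ I (φ i x)) (wordMap φ I (φ i y)) := by ring
        _ ≤ _ := by gcongr
    · calc Λ (φ i x) * L i x ≤ (e1 * Λ (φ i y)) * (e2 * L i y) := by
            gcongr; exact (hd i).holder x hx y hy
        _ = e2 * e1 * (Λ (φ i y) * L i y) := by ring
        _ ≤ _ := by gcongr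

/-- The properties of a self-conformal set with strong separation on which all later arguments
rest: up to the factor `C`, the map `φ_I` scales distances in `X` by `Diam (X_I)`. -/
structure IsQuasiSimilar [MetricSpace E] (φ : ι → E → E) (X : Set E) (C ρ : ℝ) : Prop where
  isCompact : IsCompact X
  nontrivial : X.Nontrivial
  eq_iUnion : X = ⋃ i, φ i '' X
  sep : StrongSeparation φ X
  one_le : 1 ≤ C
  rho_pos : 0 < ρ
  rho_lt : ρ < 1
  upper : ∀ I, ∀ x ∈ X, ∀ y ∈ X,
    dist (wordMap φ I x) (wordMap φ I y) ≤ C * diam (cylinder φ X I) * dist x y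
  lower : ∀ I, ∀ x ∈ X, ∀ y ∈ X,
    diam (cylinder φ X I) * dist x y ≤ C * dist (wordMap φ I x) (wordMap φ I y)
  cdiam_pos : ∀ I, 0 < diam (cylinder φ X I)
  diam_le : ∀ I, diam (cylinder φ X I) ≤ ρ ^ I.length * diam X

lemma mapsTo_of_eq_iUnion {φ : ι → E → E} {X : Set E} (h : X = ⋃ i, φ i '' X) (i : ι) :
    MapsTo (φ i) X X := fun x hx => by
  rw [h]; exact mem_iUnion.2 ⟨i, mem_image_of_mem _ hx⟩

lemma dist_wordMap_le [PseudoMetricSpace E] {φ : ι → E → E} {K : Set E}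
    (hmaps : ∀ i, MapsTo (φ i) K K) {ρ : ℝ} (hρ0 : 0 ≤ ρ)
    (hρ : ∀ i, ∀ x ∈ K, ∀ y ∈ K, dist (φ i x) (φ i y) ≤ ρ * dist x y) (I : List ι) :
    ∀ x ∈ K, ∀ y ∈ K, dist (wordMap φ I x) (wordMap φ I y) ≤ ρ ^ I.length * dist x y := by
  induction I with
  | nil => intro x _ y _; simp [wordMap]
  | cons i I ih =>
    intro x hx y hy
    refine (hρ i _ (wordMap_mapsTo hmaps I hx) _ (wordMap_mapsTo hmaps I hy)).trans ?_
    rw [List.length_cons, pow_succ', mul_assoc]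
    exact mul_le_mul_of_nonneg_left (ih x hx y hy) hρ0

/-- Taking suprema over pairs in `X` shows that `Λ` equals `Diam(X_I) / Diam(X)` up to the factor
`M`; putting the diameter in place of `Λ` turns `M` into `M ^ 2`. -/
lemma isQuasiSimilar_of_distortion [MetricSpace E] {φ : ι → E → E} {X : Set E}
    (hXc : IsCompact X) (hXn : X.Nontrivial) (hX : X = ⋃ i, φ i '' X) (hsep : StrongSeparation φ X)
    {ρ : ℝ} (hρ0 : 0 < ρ) (hρ1 : ρ < 1)
    (hρ : ∀ i, ∀ x ∈ X, ∀ y ∈ X, dist (φ i x) (φ i y) ≤ ρ * dist x y)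
    {M : ℝ} (hM : 0 < M) (h : ∀ I, ∃ Λ > 0, ∀ x ∈ X, ∀ y ∈ X,
      dist (wordMap φ I x) (wordMap φ I y) ≤ M * (Λ * dist x y) ∧
      Λ * dist x y ≤ M * dist (wordMap φ I x) (wordMap φ I y)) :
    ∃ C, IsQuasiSimilar φ X C ρ := by
  have hmaps := mapsTo_of_eq_iUnion hX
  obtain ⟨x₀, hx₀, y₀, hy₀, hxy₀⟩ := hXn
  have hD : 0 < diam X := (dist_pos.2 hxy₀).trans_le (dist_le_diam_of_mem hXc.isBounded hx₀ hy₀)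
  have hsub : ∀ I, cylinder φ X I ⊆ X := fun I => (wordMap_mapsTo hmaps I).image_subset
  have hbd : ∀ I, Bornology.IsBounded (cylinder φ X I) := fun I => hXc.isBounded.subset (hsub I)
  set D := diam X with hDdef
  set C := max 1 (max (M ^ 2 / D) (M ^ 2 * D)) with hC
  have hC1 : M ^ 2 / D ≤ C := (le_max_left _ _).trans (le_max_right _ _)
  have hC2 : M ^ 2 * D ≤ C := (le_max_right _ _).trans (le_max_right _ _)
  have hdiam : ∀ I x y, x ∈ X → y ∈ X →
      dist (wordMap φ I x) (wordMap φ I y) ≤ diam (cylinder φ X I) := fun I x y hx hy =>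
    dist_le_diam_of_mem (hbd I) (mem_image_of_mem _ hx) (mem_image_of_mem _ hy)
  have hlow : ∀ I, ∀ Λ > 0, (∀ x ∈ X, ∀ y ∈ X, Λ * dist x y ≤
      M * dist (wordMap φ I x) (wordMap φ I y)) → D * Λ ≤ M * diam (cylinder φ X I) := by
    intro I Λ hΛ hI
    have h1 : D ≤ M * diam (cylinder φ X I) / Λ := by
      refine diam_le_of_forall_dist_le (by positivity) fun u hu v hv => ?_
      rw [le_div_iff₀ hΛ, mul_comm]
      refine (hI u hu v hv).trans ?_
      gcongr
      exact hdiam I u v hu hv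
    rwa [le_div_iff₀ hΛ] at h1
  refine ⟨C, hXc, ⟨x₀, hx₀, y₀, hy₀, hxy₀⟩, hX, hsep, le_max_left _ _, hρ0, hρ1, ?_, ?_, ?_, ?_⟩
  · intro I x hx y hy
    obtain ⟨Λ, hΛ, hI⟩ := h I
    have h1 := hlow I Λ hΛ fun u hu v hv => (hI u hu v hv).2
    calc dist (wordMap φ I x) (wordMap φ I y) ≤ M * (Λ * dist x y) := (hI x hx y hy).1
      _ = M / D * (D * Λ) * dist x y := by field_simp
      _ ≤ M / D * (M * diam (cylinder φ X I)) * dist x y := by gcongr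
      _ = M ^ 2 / D * diam (cylinder φ X I) * dist x y := by ring
      _ ≤ _ := by gcongr
  · intro I x hx y hy
    obtain ⟨Λ, hΛ, hI⟩ := h I
    have h1 : diam (cylinder φ X I) ≤ M * (Λ * D) := by
      refine diam_le_of_forall_dist_le (by positivity) ?_
      rintro _ ⟨u, hu, rfl⟩ _ ⟨v, hv, rfl⟩
      refine (hI u hu v hv).1.trans ?_
      gcongr
      exact dist_le_diam_of_mem hXc.isBounded hu hv
    calc diam (cylinder φ X I) * dist x y ≤ M * (Λ * D) * dist x y := by gcongr
      _ = M * D * (Λ * dist x y) := by ring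
      _ ≤ M * D * (M * dist (wordMap φ I x) (wordMap φ I y)) :=
        mul_le_mul_of_nonneg_left (hI x hx y hy).2 (by positivity)
      _ = M ^ 2 * D * dist (wordMap φ I x) (wordMap φ I y) := by ring
      _ ≤ _ := by gcongr
  · intro I
    obtain ⟨Λ, hΛ, hI⟩ := h I
    have h1 := hlow I Λ hΛ fun u hu v hv => (hI u hu v hv).2
    exact pos_of_mul_pos_right ((mul_pos hD hΛ).trans_le h1) hM.le
  · intro I
    refine diam_le_of_forall_dist_le (by positivity) ?_
    rintro _ ⟨u, hu, rfl⟩ _ ⟨v, hv, rfl⟩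
    refine (dist_wordMap_le hmaps hρ0.le hρ I u hu v hv).trans ?_
    gcongr
    exact dist_le_diam_of_mem hXc.isBounded hu hv

/-- A finite family of contractions has a common contraction ratio in `(0, 1)`. -/
lemma exists_common_ratio [Fintype ι] [PseudoMetricSpace E] {φ : ι → E → E} {K : Set E}
    (h : ∀ i, ∃ r : ℝ≥0, r < 1 ∧ LipschitzOnWith r (φ i) K) :
    ∃ ρ : ℝ, 0 < ρ ∧ ρ < 1 ∧ ∀ i, ∀ x ∈ K, ∀ y ∈ K, dist (φ i x) (φ i y) ≤ ρ * dist x y := by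
  choose r hr1 hr using h
  refine ⟨max (1 / 2) ((Finset.univ.sup r : ℝ≥0) : ℝ), by positivity, max_lt (by norm_num) ?_,
    fun i x hx y hy => ?_⟩
  · exact_mod_cast (Finset.sup_lt_iff (by simp)).2 fun i _ => hr1 i
  · refine ((hr i).dist_le_mul x hx y hy).trans ?_
    gcongr
    refine le_max_of_le_right ?_
    exact_mod_cast Finset.le_sup (Finset.mem_univ i)

/-- A self-conformal set with the strong separation condition is quasi-similar to its cylinders. -/
theorem exists_isQuasiSimilar [Fintype ι] [NormedAddCommGroup E] [NormedSpace ℝ E]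
    [FiniteDimensional ℝ E] {φ : ι → E → E} {K X : Set E} (hφ : IsConformalIFS φ K)
    (hX : IsAttractor φ K X) (hsep : StrongSeparation φ X) (hXn : X.Nontrivial) :
    ∃ C ρ, IsQuasiSimilar φ X C ρ := by
  obtain ⟨ρ, hρ0, hρ1, hρ⟩ := exists_common_ratio hφ.isIFS.contracting
  have hdist : ∀ i, ∃ (L : E → ℝ) (C α : ℝ), 0 ≤ C ∧ 0 < α ∧ HasDistortion (φ i) K L C α := by
    intro i
    obtain ⟨V, f, hVo, -, hKV, hfφ, hinj, hconf, ⟨r, hr1, hr⟩, ⟨a, ha, haV⟩, ⟨b, hb, hbV⟩,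
      α, c, hα, hc, hhol⟩ := hφ.extension i
    obtain ⟨C, hC, h⟩ := exists_hasDistortion hVo hφ.isCompact hKV hinj hconf
      (fun x hx y hy => (hr.dist_le_mul x (hKV hx) y (hKV hy)).trans
        (mul_le_of_le_one_left dist_nonneg (by exact_mod_cast hr1.le)))
      ha haV (fun x hx => (hbV x hx).trans hb.le) hc hα hhol
    exact ⟨_, C, α, hC, hα, h.congr hfφ⟩
  choose L C α hC hα hd using hdist
  -- Sum of the geometric series of the errors `C i * (ρ ^ k * r) ^ α i` over `k`, so that `H r - H
  -- (ρ * r)` is the one-step error summed over all letters.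
  set H : ℝ → ℝ := fun r => ∑ i, C i * r ^ α i / (1 - ρ ^ α i) with hH
  have hρα : ∀ i, 0 < 1 - ρ ^ α i := fun i =>
    sub_pos.2 (Real.rpow_lt_one hρ0.le hρ1 (hα i))
  have hH0 : ∀ r, 0 ≤ r → 0 ≤ H r := fun r hr => Finset.sum_nonneg fun i _ => by
    have := hρα i
    have := hC i
    positivity
  have hHmono : ∀ r r', 0 ≤ r → r ≤ r' → H r ≤ H r' := by
    intro r r' hr hrr'
    refine Finset.sum_le_sum fun i _ => ?_
    have := hρα i
    have := hC i
    have := (hα i).le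
    gcongr
  have hHstep : ∀ i r, 0 ≤ r → C i * r ^ α i + H (ρ * r) ≤ H r := by
    intro i r hr
    have h1 : H r - H (ρ * r) = ∑ j, C j * r ^ α j := by
      rw [hH, ← Finset.sum_sub_distrib]
      refine Finset.sum_congr rfl fun j _ => ?_
      have := (hρα j).ne'
      rw [Real.mul_rpow hρ0.le hr]
      field_simp
    have h2 : C i * r ^ α i ≤ ∑ j, C j * r ^ α j :=
      Finset.single_le_sum (f := fun j => C j * r ^ α j)
        (fun j _ => mul_nonneg (hC j) (by positivity)) (Finset.mem_univ i)
    linarith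
  have hbd := hφ.isCompact.isBounded
  set e := Real.exp (H (diam K)) with he
  have he0 : 0 < e := Real.exp_pos _
  have hexp : ∀ x ∈ K, ∀ y ∈ K, Real.exp (H (dist x y)) ≤ e := fun x hx y hy =>
    Real.exp_le_exp.2 (hHmono _ _ dist_nonneg (dist_le_diam_of_mem hbd hx hy))
  -- The scale is frozen at a base point `o`: one factor `e` comes from the distortion, the other
  -- from replacing `Λ x` by `Λ o`.
  obtain ⟨o, ho⟩ := hX.nonempty
  have hoK := hX.subset ho
  suffices ∃ C, IsQuasiSimilar φ X C ρ from this.imp fun C h => ⟨ρ, h⟩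
  refine isQuasiSimilar_of_distortion hX.isCompact hXn hX.eq_iUnion hsep hρ0 hρ1
    (fun i x hx y hy => hρ i x (hX.subset hx) y (hX.subset hy)) (M := e ^ 2) (by positivity) ?_
  intro I
  obtain ⟨Λ, hΛ, h⟩ := exists_wordMap_distortion hφ.isIFS.mapsTo hd hρ hHmono hH0 hHstep I
  refine ⟨Λ o, hΛ o hoK, fun x hx y hy => ?_⟩
  have hxK := hX.subset hx
  have hyK := hX.subset hy
  obtain ⟨h1, h2, -⟩ := h x hxK y hyK
  have h3 := (h x hxK o hoK).2.2
  have h4 := (h o hoK x hxK).2.2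
  have pΛ := hΛ x hxK
  have po := hΛ o hoK
  have q1 := hexp x hxK y hyK
  have q2 := hexp x hxK o hoK
  have q3 := hexp o hoK x hxK
  constructor
  · calc _ ≤ _ := h1
      _ ≤ e * ((e * Λ o) * dist x y) := by
        gcongr
        exact h3.trans (by gcongr)
      _ = _ := by ring
  · calc Λ o * dist x y ≤ (e * Λ x) * dist x y := by
          gcongr
          exact h4.trans (by gcongr)
      _ = e * (Λ x * dist x y) := by ring
      _ ≤ e * (e * dist (wordMap φ I x) (wordMap φ I y)) :=
        mul_le_mul_of_nonneg_left (h2.trans (by gcongr)) he0.le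
      _ = _ := by ring

end Distortion

/-! ### Initial words of sequences. -/

section Prefixes

variable {ι : Type*}

/-- The initial word of length `n` of a sequence. -/
def pre (a : ℕ → ι) (n : ℕ) : List ι := List.ofFn fun k : Fin n => a k

@[simp] lemma length_pre (a : ℕ → ι) (n : ℕ) : (pre a n).length = n := by simp [pre]

@[simp] lemma pre_zero (a : ℕ → ι) : pre a 0 = [] := by simp [pre]

lemma pre_eq_iff {a b : ℕ → ι} {n : ℕ} : pre a n = pre b n ↔ ∀ j < n, a j = b j := by
  rw [pre, pre, List.ofFn_injective.eq_iff, funext_iff]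
  exact ⟨fun h j hj => h ⟨j, hj⟩, fun h k => h k k.2⟩

lemma pre_add (a : ℕ → ι) (n m : ℕ) : pre a (n + m) = pre a n ++ pre (fun j => a (n + j)) m := by
  refine List.ext_getElem (by simp) fun k h1 h2 => ?_
  rw [List.getElem_append]
  split_ifs with h
  · simp [pre]
  · have : n ≤ k := by simpa using h
    simp [pre, Nat.add_sub_cancel' this]

lemma pre_succ (a : ℕ → ι) (n : ℕ) : pre a (n + 1) = pre a n ++ [a n] := by
  rw [pre_add]; simp [pre]

lemma pre_succ' (a : ℕ → ι) (n : ℕ) : pre a (n + 1) = a 0 :: pre (fun j => a (j + 1)) n := by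
  simp [pre, List.ofFn_succ]

/-- A word followed by a sequence. -/
def prepend (I : List ι) (a : ℕ → ι) (j : ℕ) : ι :=
  if h : j < I.length then I[j] else a (j - I.length)

lemma pre_prepend (I : List ι) (a : ℕ → ι) (n : ℕ) :
    pre (prepend I a) (I.length + n) = I ++ pre a n := by
  rw [pre_add]
  congr 1
  · refine List.ext_getElem (by simp) fun k h1 h2 => ?_
    simp [pre, prepend]
  · congr 1
    funext j
    simp [prepend]

end Prefixes

/-! ### Geometry and coding of cylinders. -/

section Cylinders

variable {ι E : Type*}

lemma cylinder_append (φ : ι → E → E) (X : Set E) (I J : List ι) :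
    cylinder φ X (I ++ J) = wordMap φ I '' cylinder φ X J := by
  rw [cylinder, wordMap_append, image_comp]; rfl

lemma cylinder_nil (φ : ι → E → E) (X : Set E) : cylinder φ X [] = X := by
  simp [cylinder, wordMap]

/-- The diameter of a cylinder. -/
noncomputable abbrev cdiam [PseudoMetricSpace E] (φ : ι → E → E) (X : Set E) (I : List ι) : ℝ :=
  diam (cylinder φ X I)

namespace IsQuasiSimilar

variable [MetricSpace E] {φ : ι → E → E} {X : Set E} {C ρ : ℝ}

lemma mapsTo (h : IsQuasiSimilar φ X C ρ) (I : List ι) : MapsTo (wordMap φ I) X X :=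
  wordMap_mapsTo (mapsTo_of_eq_iUnion h.eq_iUnion) I

lemma cylinder_subset (h : IsQuasiSimilar φ X C ρ) (I : List ι) : cylinder φ X I ⊆ X :=
  (h.mapsTo I).image_subset

lemma cylinder_append_subset (h : IsQuasiSimilar φ X C ρ) (I J : List ι) :
    cylinder φ X (I ++ J) ⊆ cylinder φ X I := by
  rw [cylinder_append]
  exact image_mono (h.cylinder_subset J)

lemma isBounded_cylinder (h : IsQuasiSimilar φ X C ρ) (I : List ι) :
    Bornology.IsBounded (cylinder φ X I) := h.isCompact.isBounded.subset (h.cylinder_subset I)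

lemma C_pos (h : IsQuasiSimilar φ X C ρ) : 0 < C := one_pos.trans_le h.one_le

lemma nonempty (h : IsQuasiSimilar φ X C ρ) : X.Nonempty := h.nontrivial.nonempty

lemma diam_pos (h : IsQuasiSimilar φ X C ρ) : 0 < diam X := by
  obtain ⟨x, hx, y, hy, hxy⟩ := h.nontrivial
  exact (dist_pos.2 hxy).trans_le (dist_le_diam_of_mem h.isCompact.isBounded hx hy)

lemma dist_le_cdiam (h : IsQuasiSimilar φ X C ρ) (I : List ι) {x y : E}
    (hx : x ∈ cylinder φ X I) (hy : y ∈ cylinder φ X I) : dist x y ≤ cdiam φ X I :=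
  dist_le_diam_of_mem (h.isBounded_cylinder I) hx hy

/-- One half of the quasi-multiplicativity of diameters, from `upper` on pairs of points of `X_J`;
`le_cdiam_append` is the other half. -/
lemma cdiam_append_le (h : IsQuasiSimilar φ X C ρ) (I J : List ι) :
    cdiam φ X (I ++ J) ≤ C * (cdiam φ X I * cdiam φ X J) := by
  have := h.C_pos
  refine diam_le_of_forall_dist_le (by positivity) ?_
  rw [cylinder_append]
  rintro _ ⟨u, hu, rfl⟩ _ ⟨v, hv, rfl⟩
  refine (h.upper I u (h.cylinder_subset J hu) v (h.cylinder_subset J hv)).trans ?_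
  rw [mul_assoc]
  gcongr
  exact h.dist_le_cdiam J hu hv

lemma le_cdiam_append (h : IsQuasiSimilar φ X C ρ) (I J : List ι) :
    cdiam φ X I * cdiam φ X J ≤ C * cdiam φ X (I ++ J) := by
  have hI := h.cdiam_pos I
  have := h.C_pos
  rw [← le_div_iff₀' hI]
  refine diam_le_of_forall_dist_le (by positivity) fun u hu v hv => ?_
  rw [le_div_iff₀' hI]
  refine (h.lower I u (h.cylinder_subset J hu) v (h.cylinder_subset J hv)).trans ?_
  gcongr
  refine h.dist_le_cdiam _ ?_ ?_ <;> rw [cylinder_append]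
  exacts [mem_image_of_mem _ hu, mem_image_of_mem _ hv]

lemma injOn (h : IsQuasiSimilar φ X C ρ) (I : List ι) : InjOn (wordMap φ I) X := by
  intro x hx y hy hxy
  have := h.lower I x hx y hy
  rw [hxy, dist_self, mul_zero] at this
  by_contra hne
  exact absurd this (not_le.2 (mul_pos (h.cdiam_pos I) (dist_pos.2 hne)))

lemma continuousOn (h : IsQuasiSimilar φ X C ρ) (I : List ι) : ContinuousOn (wordMap φ I) X := by
  have := h.C_pos
  refine LipschitzOnWith.continuousOn (K := (C * cdiam φ X I).toNNReal)
    (LipschitzOnWith.of_dist_le_mul fun x hx y hy => ?_)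
  rw [Real.coe_toNNReal _ (by positivity)]
  exact h.upper I x hx y hy

lemma isCompact_cylinder (h : IsQuasiSimilar φ X C ρ) (I : List ι) :
    IsCompact (cylinder φ X I) := h.isCompact.image_of_continuousOn (h.continuousOn I)

lemma nonempty_cylinder (h : IsQuasiSimilar φ X C ρ) (I : List ι) :
    (cylinder φ X I).Nonempty := h.nonempty.image _

lemma cylinder_cons_subset (h : IsQuasiSimilar φ X C ρ) (i : ι) (I : List ι) :
    cylinder φ X (i :: I) ⊆ φ i '' X := h.cylinder_append_subset [i] I

/-- Strong separation determines the first letter, and injectivity of that map on `X` allows it to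
be peeled off. -/
lemma eq_of_mem_cylinder (h : IsQuasiSimilar φ X C ρ) {I J : List ι} {x : E}
    (hI : x ∈ cylinder φ X I) (hJ : x ∈ cylinder φ X J) (hlen : I.length = J.length) : I = J := by
  induction I generalizing J x with
  | nil => exact (List.length_eq_zero_iff.1 hlen.symm).symm
  | cons i I ih =>
    cases J with
    | nil => simp at hlen
    | cons j J =>
      have hij : i = j := by
        by_contra hne
        exact disjoint_left.1 (h.sep i j hne) (h.cylinder_cons_subset i I hI)
          (h.cylinder_cons_subset j J hJ)
      subst hij
      rw [show i :: I = [i] ++ I from rfl, cylinder_append] at hI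
      rw [show i :: J = [i] ++ J from rfl, cylinder_append] at hJ
      obtain ⟨u, hu, hux⟩ := hI
      obtain ⟨v, hv, hvx⟩ := hJ
      have huv := h.injOn [i] (h.cylinder_subset _ hu) (h.cylinder_subset _ hv) (hux.trans hvx.symm)
      subst huv
      rw [ih hu hv (by simpa using hlen)]

/-- Every point of `X` has a coding, so a coding can be chosen for all points at once. -/
lemma exists_code (h : IsQuasiSimilar φ X C ρ) :
    ∃ c : E → ℕ → ι, (∀ x ∈ X, ∀ n, x ∈ cylinder φ X (pre (c x) n)) ∧
      ∀ x ∉ X, ∀ y ∉ X, c x = c y := by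
  classical
  have hstep : ∀ x ∈ X, ∃ i, ∃ y ∈ X, φ i y = x := fun x hx => by
    rw [h.eq_iUnion] at hx
    obtain ⟨i, y, hy, hyx⟩ := mem_iUnion.1 hx
    exact ⟨i, y, hy, hyx⟩
  obtain ⟨x₀, hx₀⟩ := h.nonempty
  obtain ⟨i₀, -⟩ := hstep x₀ hx₀
  have hstep' : ∀ x, ∃ p : ι × E, x ∈ X → p.2 ∈ X ∧ φ p.1 p.2 = x := fun x => by
    by_cases hx : x ∈ X
    · obtain ⟨i, y, hy, hyx⟩ := hstep x hx
      exact ⟨(i, y), fun _ => ⟨hy, hyx⟩⟩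
    · exact ⟨(i₀, x₀), fun hx' => absurd hx' hx⟩
  choose p hp using hstep'
  -- A constant code off `X` keeps the letter sets measurable in the whole space.
  refine ⟨fun x => if x ∈ X then fun n => (p ((fun y => (p y).2)^[n] x)).1 else fun _ => i₀,
    fun x hx n => ?_, fun x hx y hy => by simp [hx, hy]⟩
  simp only [hx, if_true]
  induction n generalizing x with
  | zero => simpa [cylinder_nil] using hx
  | succ n ih =>
    have h1 := ih _ (hp x hx).1
    rw [pre_succ']
    exact ⟨_, h1.choose_spec.1, by
      rw [wordMap, Function.comp_apply]
      simp only [Function.iterate_succ, Function.comp_apply, Function.iterate_zero, id_eq]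
      rw [h1.choose_spec.2]
      exact (hp x hx).2⟩

lemma pre_eq_of_mem (h : IsQuasiSimilar φ X C ρ) {a : ℕ → ι} {x : E}
    (ha : ∀ n, x ∈ cylinder φ X (pre a n)) {I : List ι} (hI : x ∈ cylinder φ X I) :
    pre a I.length = I := h.eq_of_mem_cylinder (ha _) hI (by simp)

/-- Every sequence is the coding of some point. -/
lemma exists_point (h : IsQuasiSimilar φ X C ρ) (a : ℕ → ι) :
    ∃ x, ∀ n, x ∈ cylinder φ X (pre a n) := by
  have := IsCompact.nonempty_iInter_of_sequence_nonempty_isCompact_isClosed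
    (fun n => cylinder φ X (pre a n)) (fun n => by
      simp only [pre_succ]; exact h.cylinder_append_subset _ _)
    (fun n => h.nonempty_cylinder _) (h.isCompact_cylinder _)
    (fun n => (h.isCompact_cylinder _).isClosed)
  exact this.imp fun x hx => mem_iInter.1 hx

lemma cdiam_pre_tendsto (h : IsQuasiSimilar φ X C ρ) :
    ∀ ε > 0, ∃ N, ∀ n ≥ N, ∀ I : List ι, I.length = n → cdiam φ X I < ε := by
  intro ε hε
  have ht : Tendsto (fun n : ℕ => ρ ^ n * diam X) atTop (𝓝 0) := by
    simpa using (tendsto_pow_atTop_nhds_zero_of_lt_one h.rho_pos.le h.rho_lt).mul_const (diam X)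
  obtain ⟨N, hN⟩ := eventually_atTop.1 (ht.eventually_lt_const hε)
  exact ⟨N, fun n hn I hI => (h.diam_le I).trans_lt (by rw [hI]; exact hN n hn)⟩

lemma cylinder_eq_iUnion (h : IsQuasiSimilar φ X C ρ) (J : List ι) (n : ℕ) :
    cylinder φ X J = ⋃ I : Fin n → ι, cylinder φ X (J ++ List.ofFn I) := by
  refine subset_antisymm ?_ (iUnion_subset fun I => h.cylinder_append_subset _ _)
  rintro _ ⟨x, hx, rfl⟩
  obtain ⟨c, hc, -⟩ := h.exists_code
  refine mem_iUnion.2 ⟨fun k => c x k, ?_⟩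
  rw [cylinder_append]
  exact mem_image_of_mem _ (hc x hx n)

lemma nonempty_index (h : IsQuasiSimilar φ X C ρ) : Nonempty ι := by
  obtain ⟨c, -⟩ := h.exists_code
  exact ⟨c h.nonempty.some 0⟩

end IsQuasiSimilar

lemma exists_pos_forall_le_of_finite {κ : Type*} [Finite κ] {f : κ → ℝ} (hf : ∀ k, 0 < f k) :
    ∃ ε > 0, ∀ k, ε ≤ f k := by
  cases isEmpty_or_nonempty κ
  · exact ⟨1, one_pos, fun k => isEmptyElim k⟩
  · obtain ⟨k, hk⟩ := Finite.exists_min f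
    exact ⟨f k, hf k, hk⟩

namespace IsQuasiSimilar

variable [MetricSpace E] {φ : ι → E → E} {X : Set E} {C ρ : ℝ} [Finite ι]

lemma exists_gap (h : IsQuasiSimilar φ X C ρ) :
    ∃ δ > 0, ∀ i j, i ≠ j → ∀ x ∈ φ i '' X, ∀ y ∈ φ j '' X, δ ≤ dist x y := by
  have : ∀ p : {p : ι × ι // p.1 ≠ p.2}, ∃ δ : ℝ, 0 < δ ∧
      ∀ x ∈ φ p.1.1 '' X, ∀ y ∈ φ p.1.2 '' X, δ ≤ dist x y := by
    rintro ⟨⟨i, j⟩, hij⟩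
    obtain ⟨r, hr, hlt⟩ := exists_pos_forall_lt_edist (h.isCompact_cylinder [i])
      (h.isCompact_cylinder [j]).isClosed (h.sep i j hij)
    refine ⟨r, hr, fun x hx y hy => ?_⟩
    have := hlt x hx y hy
    rw [edist_nndist] at this
    exact_mod_cast this.le
  choose δ hδ hle using this
  obtain ⟨ε, hε, hεle⟩ := exists_pos_forall_le_of_finite hδ
  exact ⟨ε, hε, fun i j hij x hx y hy => (hεle ⟨(i, j), hij⟩).trans (hle ⟨(i, j), hij⟩ x hx y hy)⟩

/-- The trace on `X` of a small set is contained in a cylinder of comparable diameter. -/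
lemma exists_cylinder_superset (h : IsQuasiSimilar φ X C ρ) :
    ∃ δ > 0, ∃ B > 0, ∀ U : Set E, Bornology.IsBounded U → ∀ η > 0, ∃ I : List ι,
      U ∩ X ⊆ cylinder φ X I ∧ cdiam φ X I ≤ B * diam U + η ∧ (diam U < δ → I ≠ []) := by
  obtain ⟨δ, hδ, hgap⟩ := h.exists_gap
  obtain ⟨c, hc, -⟩ := h.exists_code
  have hC := h.C_pos
  refine ⟨δ, hδ, C / δ, by positivity, fun U hU η hη => ?_⟩
  -- If `U ∩ X` is empty or all its points have one code, there is no longest common prefix; a long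
  -- word with diameter below `η` serves instead.
  obtain ⟨N, hN⟩ := h.cdiam_pre_tendsto η hη
  have hlong : ∀ x, cdiam φ X (pre (c x) (N + 1)) ≤ C / δ * diam U + η ∧
      (diam U < δ → pre (c x) (N + 1) ≠ []) := fun x => by
    refine ⟨?_, fun _ h0 => ?_⟩
    · have : 0 ≤ C / δ * diam U := by positivity
      linarith [hN (N + 1) (by omega) (pre (c x) (N + 1)) (by simp)]
    · simpa using congrArg List.length h0
  rcases (U ∩ X).eq_empty_or_nonempty with h0 | ⟨x, hxU, hxX⟩
  · obtain ⟨x, hx⟩ := h.nonempty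
    exact ⟨pre (c x) (N + 1), by simp [h0], hlong x⟩
  by_cases hall : ∀ n, ∀ y ∈ U ∩ X, pre (c y) n = pre (c x) n
  · exact ⟨pre (c x) (N + 1), fun y hy => by rw [← hall _ y hy]; exact hc y hy.2 _, hlong x⟩
  push Not at hall
  classical
  -- `k` is the length of the longest common prefix. Undoing its map takes two points of `U` into
  -- different first-level cylinders, at distance at least `δ`; `lower` then bounds the diameter.
  obtain ⟨k, hk⟩ : ∃ k, Nat.find hall = k + 1 := Nat.exists_eq_succ_of_ne_zero fun h0 => by
    obtain ⟨y, -, hy⟩ := Nat.find_spec hall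
    rw [h0] at hy
    simp at hy
  obtain ⟨y, hyUX, hy⟩ := Nat.find_spec hall
  rw [hk] at hy
  have hpre : ∀ u ∈ U ∩ X, pre (c u) k = pre (c x) k := fun u hu => by
    have := Nat.find_min hall (m := k) (by omega)
    push Not at this
    exact this u hu
  have hne : c x k ≠ c y k := fun heq => hy (by rw [pre_succ, pre_succ, hpre y hyUX, heq])
  have hx1 := hc x hxX (k + 1)
  have hy1 := hc y hyUX.2 (k + 1)
  rw [pre_succ, cylinder_append] at hx1 hy1
  rw [hpre y hyUX] at hy1
  obtain ⟨u, hu, hux⟩ := hx1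
  obtain ⟨v, hv, hvy⟩ := hy1
  have huv := hgap _ _ hne u hu v hv
  have hxy : dist x y ≤ diam U := dist_le_diam_of_mem hU hxU hyUX.1
  have hlow := h.lower (pre (c x) k) u (h.cylinder_subset [c x k] hu) v
    (h.cylinder_subset [c y k] hv)
  rw [hux, hvy] at hlow
  refine ⟨pre (c x) k, fun u hu => by rw [← hpre u hu]; exact hc u hu.2 k, ?_, fun hlt h0 => ?_⟩
  · have hD := (h.cdiam_pos (pre (c x) k)).le
    have : cdiam φ X (pre (c x) k) * δ ≤ C * diam U :=
      (mul_le_mul_of_nonneg_left huv hD).trans (hlow.trans (by gcongr))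
    rw [div_mul_eq_mul_div]
    rw [← le_div_iff₀ hδ] at this
    linarith
  · rw [h0] at hux hvy
    have hux' : u = x := hux
    have hvy' : v = y := hvy
    rw [hux', hvy'] at huv
    linarith

end IsQuasiSimilar

end Cylinders

/-! ### Lower dimension bounds from measures. -/

section Frostman

variable {ι E : Type*} [MetricSpace E] [MeasurableSpace E] [BorelSpace E]
  {φ : ι → E → E} {X : Set E} {C ρ : ℝ}

/-- The mass distribution principle, tested on cylinders only. -/
lemma IsQuasiSimilar.le_dimH_of_measure [Finite ι] (h : IsQuasiSimilar φ X C ρ) {ν : Measure E}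
    {t : ℝ≥0} {c : ℝ} (ht : 0 < t) (hc : 0 < c) (hνX : ν Xᶜ = 0)
    (hν : ∀ I, ν (cylinder φ X I) ≤ ENNReal.ofReal (c * cdiam φ X I ^ (t : ℝ))) {S : Set E}
    (hS : ν S ≠ 0) : (t : ℝ≥0∞) ≤ dimH S := by
  obtain ⟨δ, hδ, B, hB, hcov⟩ := h.exists_cylinder_superset
  have ht' : (0 : ℝ) < t := ht
  have hU : ∀ U : Set E, ediam U ≤ 1 →
      ν U ≤ ENNReal.ofReal (c * B ^ (t : ℝ)) * ediam U ^ (t : ℝ) := by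
    intro U hU1
    have hUtop : ediam U ≠ ∞ := ne_top_of_le_ne_top ENNReal.one_ne_top hU1
    have hUb : Bornology.IsBounded U := isBounded_iff_ediam_ne_top.2 hUtop
    have h1 : ∀ η > 0, ν U ≤ ENNReal.ofReal (c * (B * diam U + η) ^ (t : ℝ)) := by
      intro η hη
      obtain ⟨I, hI, hD, -⟩ := hcov U hUb η hη
      calc ν U ≤ ν (U ∩ X ∪ Xᶜ) := measure_mono fun x hx => by
            by_cases hxX : x ∈ X
            exacts [Or.inl ⟨hx, hxX⟩, Or.inr hxX]
        _ ≤ ν (U ∩ X) + ν Xᶜ := measure_union_le _ _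
        _ ≤ ν (cylinder φ X I) := by rw [hνX, add_zero]; exact measure_mono hI
        _ ≤ _ := hν I
        _ ≤ _ := by
          refine ENNReal.ofReal_le_ofReal ?_
          gcongr
    have hlim : Tendsto (fun η : ℝ => ENNReal.ofReal (c * (B * diam U + η) ^ (t : ℝ))) (𝓝[>] 0)
        (𝓝 (ENNReal.ofReal (c * (B * diam U + 0) ^ (t : ℝ)))) := by
      have : Continuous fun η : ℝ => ENNReal.ofReal (c * (B * diam U + η) ^ (t : ℝ)) :=
        ENNReal.continuous_ofReal.comp (continuous_const.mul
          ((continuous_const.add continuous_id).rpow_const fun _ => Or.inr ht'.le))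
      exact (this.tendsto 0).mono_left nhdsWithin_le_nhds
    have h2 := ge_of_tendsto hlim (eventually_nhdsWithin_of_forall h1)
    refine h2.trans (le_of_eq ?_)
    rw [add_zero, Real.mul_rpow hB.le diam_nonneg, ← mul_assoc, ENNReal.ofReal_mul (by positivity),
      ← ENNReal.ofReal_rpow_of_nonneg diam_nonneg ht'.le, Metric.diam, ENNReal.ofReal_toReal hUtop]
  set k := ENNReal.ofReal (c * B ^ (t : ℝ)) with hk
  have hk0 : k ≠ 0 := by
    rw [hk, Ne, ENNReal.ofReal_eq_zero, not_le]
    positivity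
  have hle : k⁻¹ • ν ≤ Measure.hausdorffMeasure (t : ℝ) := by
    refine Measure.le_hausdorffMeasure _ _ 1 one_pos fun U hU1 => ?_
    rw [Measure.smul_apply, smul_eq_mul]
    calc k⁻¹ * ν U ≤ k⁻¹ * (k * ediam U ^ (t : ℝ)) := by gcongr; exact hU U hU1
      _ = ediam U ^ (t : ℝ) := by
        rw [← mul_assoc, ENNReal.inv_mul_cancel hk0 ENNReal.ofReal_ne_top, one_mul]
  refine le_dimH_of_hausdorffMeasure_ne_zero fun h0 => hS ?_
  have := hle S
  rw [h0, Measure.smul_apply, smul_eq_mul, nonpos_iff_eq_zero, mul_eq_zero,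
    ENNReal.inv_eq_zero] at this
  exact this.resolve_left ENNReal.ofReal_ne_top

end Frostman

/-! ### Bernoulli measures on sequences. -/

section Bernoulli

/-- Infinite products of a probability vector. -/
lemma exists_bernoulli {κ : Type*} [Fintype κ] [MeasurableSpace κ] [MeasurableSingletonClass κ]
    {p : κ → ℝ} (hp : ∀ k, 0 ≤ p k) (hsum : ∑ k, p k = 1) :
    ∃ P : Measure (ℕ → κ), IsProbabilityMeasure P ∧ ∀ (b : ℕ → κ) (n : ℕ),
      P {b' | ∀ q < n, b' q = b q} = ENNReal.ofReal (∏ q ∈ Finset.range n, p (b q)) := by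
  let f : PMF κ := PMF.ofFintype (fun k => ENNReal.ofReal (p k)) (by
    rw [← ENNReal.ofReal_sum_of_nonneg fun k _ => hp k, hsum, ENNReal.ofReal_one])
  have : IsProbabilityMeasure f.toMeasure := PMF.toMeasure.isProbabilityMeasure f
  refine ⟨Measure.infinitePi fun _ => f.toMeasure, inferInstance, fun b n => ?_⟩
  have hset : {b' : ℕ → κ | ∀ q < n, b' q = b q} =
      Set.pi (Finset.range n : Set ℕ) fun q => {b q} := by
    ext b'; simp [Set.mem_pi]
  rw [hset, Measure.infinitePi_pi _ fun q _ => measurableSet_singleton _,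
    ENNReal.ofReal_prod_of_nonneg fun q _ => hp _]
  refine Finset.prod_congr rfl fun q _ => ?_
  rw [PMF.toMeasure_apply_singleton _ _ (measurableSet_singleton _)]
  rfl

end Bernoulli

/-! ### Sets coded by free concatenation of blocks. -/

section Blocks

variable {ι : Type*}

/-- The concatenation of a sequence of blocks of length `n`. -/
def concatBlocks {n : ℕ} (hn : 0 < n) {𝒥 : Finset (Fin n → ι)} (b : ℕ → 𝒥) (j : ℕ) : ι :=
  (b (j / n)).1 ⟨j % n, Nat.mod_lt j hn⟩

lemma concatBlocks_apply {n : ℕ} (hn : 0 < n) {𝒥 : Finset (Fin n → ι)} (b : ℕ → 𝒥) (q : ℕ)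
    (r : Fin n) : concatBlocks hn b (n * q + r) = (b q).1 r := by
  have h1 : (n * q + r) / n = q := by
    rw [Nat.mul_add_div hn, Nat.div_eq_of_lt r.2, add_zero]
  have h2 : (n * q + r) % n = r := by
    rw [Nat.mul_add_mod, Nat.mod_eq_of_lt r.2]
  simp only [concatBlocks, h1, h2]

lemma pre_concatBlocks_succ {n : ℕ} (hn : 0 < n) {𝒥 : Finset (Fin n → ι)} (b : ℕ → 𝒥) (q : ℕ) :
    pre (concatBlocks hn b) (n * (q + 1)) =
      pre (concatBlocks hn b) (n * q) ++ List.ofFn (b q).1 := by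
  rw [mul_add, mul_one, pre_add]
  congr 1
  simp only [pre, concatBlocks_apply]

lemma eq_of_pre_concatBlocks_eq {n : ℕ} (hn : 0 < n) {𝒥 : Finset (Fin n → ι)} {b b' : ℕ → 𝒥}
    {N : ℕ} (h : pre (concatBlocks hn b) N = pre (concatBlocks hn b') N) {q : ℕ} (hq : q < N / n) :
    b q = b' q := by
  refine Subtype.ext (funext fun r => ?_)
  rw [← concatBlocks_apply hn, ← concatBlocks_apply hn]
  refine pre_eq_iff.1 h _ ?_
  have h1 : n * (q + 1) ≤ N := (Nat.mul_le_mul_left n hq).trans (Nat.mul_div_le N n)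
  have := r.2
  rw [mul_add] at h1
  omega

variable {E : Type*} [MetricSpace E] {φ : ι → E → E} {X : Set E} {C ρ : ℝ}

/-- Each concatenation loses one factor `C`; dividing each block diameter by `C` pays for it. -/
lemma IsQuasiSimilar.prod_le_cdiam (h : IsQuasiSimilar φ X C ρ) {n : ℕ} (hn : 0 < n)
    {𝒥 : Finset (Fin n → ι)} (b : ℕ → 𝒥) (q : ℕ) :
    (∏ k ∈ Finset.range q, cdiam φ X (List.ofFn (b k).1) / C) * diam X ≤
      cdiam φ X (pre (concatBlocks hn b) (n * q)) := by
  have hC := h.C_pos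
  induction q with
  | zero => simp [cdiam, cylinder_nil]
  | succ q ih =>
    have h1 := h.le_cdiam_append (pre (concatBlocks hn b) (n * q)) (List.ofFn (b q).1)
    rw [Finset.prod_range_succ, pre_concatBlocks_succ]
    have h2 := h.cdiam_pos (List.ofFn (b q).1)
    calc _ = (∏ k ∈ Finset.range q, cdiam φ X (List.ofFn (b k).1) / C) * diam X *
          cdiam φ X (List.ofFn (b q).1) / C := by ring
      _ ≤ cdiam φ X (pre (concatBlocks hn b) (n * q)) * cdiam φ X (List.ofFn (b q).1) / C := by
        gcongr
      _ ≤ _ := by rwa [div_le_iff₀' hC]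

lemma IsQuasiSimilar.exists_cdiam_lower [Finite ι] (h : IsQuasiSimilar φ X C ρ) (n : ℕ) :
    ∃ ε > 0, ∀ I : List ι, I.length ≤ n → ε ≤ cdiam φ X I := by
  have : Finite {I : List ι // I.length ≤ n} := List.finite_length_le ι n
  obtain ⟨ε, hε, hle⟩ := exists_pos_forall_le_of_finite
    (f := fun I : {I : List ι // I.length ≤ n} => cdiam φ X I.1) fun I => h.cdiam_pos I.1
  exact ⟨ε, hε, fun I hI => hle ⟨I, hI⟩⟩

/-- The set of points coded by the sequences of blocks from `𝒥`. -/
def blockSet (φ : ι → E → E) (X : Set E) {n : ℕ} (hn : 0 < n) (𝒥 : Finset (Fin n → ι)) : Set E :=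
  {x | ∃ b : ℕ → 𝒥, ∀ m, x ∈ cylinder φ X (pre (concatBlocks hn b) m)}

/-- The dimension of the set coded by a set of blocks is bounded below. -/
theorem IsQuasiSimilar.le_dimH_blockSet [Finite ι] (h : IsQuasiSimilar φ X C ρ) {n : ℕ}
    (hn : 0 < n) {𝒥 : Finset (Fin n → ι)} {t : ℝ≥0} (ht : 0 < t)
    (hsum : 1 ≤ ∑ J ∈ 𝒥, (cdiam φ X (List.ofFn J) / C) ^ (t : ℝ)) :
    (t : ℝ≥0∞) ≤ dimH (blockSet φ X hn 𝒥) := by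
  borelize E
  let mκ : MeasurableSpace 𝒥 := ⊤
  have hC := h.C_pos
  -- With these weights, products over blocks are bounded by the `t`-th power of the cylinder
  -- diameter, up to a constant. Since `W ≥ 1`, normalisation only lowers them, and the Bernoulli
  -- measure satisfies the mass distribution principle.
  set wt : 𝒥 → ℝ := fun J => (cdiam φ X (List.ofFn J.1) / C) ^ (t : ℝ) with hwt
  have hwt0 : ∀ J, 0 ≤ wt J := fun J => by
    have := h.cdiam_pos (List.ofFn J.1)
    positivity
  have hW : 1 ≤ ∑ J, wt J := by
    rw [Finset.sum_coe_sort 𝒥 fun J => (cdiam φ X (List.ofFn J) / C) ^ (t : ℝ)]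
    exact hsum
  set W := ∑ J, wt J
  have hW0 : 0 < W := one_pos.trans_le hW
  obtain ⟨P, hP, hPcyl⟩ := exists_bernoulli (p := fun J => wt J / W)
    (fun J => div_nonneg (hwt0 J) hW0.le) (by rw [← Finset.sum_div, div_self hW0.ne'])
  choose pt hpt using h.exists_point
  set g : (ℕ → 𝒥) → E := fun b => pt (concatBlocks hn b) with hg
  have hgmeas : Measurable g := by
    obtain ⟨o, ho⟩ := h.nonempty
    refine measurable_of_tendsto_metrizable
      (f := fun m b => wordMap φ (pre (concatBlocks hn b) m) o) (fun m => ?_) ?_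
    -- The first `m` letters involve only blocks of index at most `m`; `min j m` is a dummy value
    -- beyond that.
    · let F : (Fin (m + 1) → 𝒥) → E := fun u =>
        wordMap φ (pre (concatBlocks hn fun j => u ⟨min j m, by omega⟩) m) o
      have : (fun b : ℕ → 𝒥 => wordMap φ (pre (concatBlocks hn b) m) o) =
          F ∘ fun b k => b k := by
        funext b
        simp only [F, Function.comp_apply]
        congr 1
        refine pre_eq_iff.2 fun j hj => ?_
        have : j / n ≤ m := (Nat.div_le_self j n).trans hj.le
        simp only [concatBlocks, min_eq_left this]
      rw [this]
      exact (measurable_of_finite F).comp (measurable_pi_lambda _ fun k => measurable_pi_apply _)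
    · refine tendsto_pi_nhds.2 fun b => tendsto_iff_dist_tendsto_zero.2 ?_
      refine squeeze_zero (fun _ => dist_nonneg) (g := fun m => ρ ^ m * diam X) (fun m => ?_) ?_
      · refine (h.dist_le_cdiam _ (mem_image_of_mem _ ho) (hpt _ m)).trans ?_
        simpa using h.diam_le (pre (concatBlocks hn b) m)
      · simpa using
          (tendsto_pow_atTop_nhds_zero_of_lt_one h.rho_pos.le h.rho_lt).mul_const (diam X)
  -- `ε` accounts for the incomplete last block of a word.
  obtain ⟨ε, hε, hεle⟩ := h.exists_cdiam_lower (φ := φ) (X := X) n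
  have hD := h.diam_pos
  have hgX : ∀ b, g b ∈ X := fun b => by simpa [cylinder_nil] using hpt (concatBlocks hn b) 0
  refine h.le_dimH_of_measure (ν := P.map g) (c := (C / ε / diam X) ^ (t : ℝ)) ht
    (by positivity) ?_ (fun I => ?_) ?_
  · rw [Measure.map_apply hgmeas h.isCompact.isClosed.measurableSet.compl]
    convert measure_empty (μ := P)
    ext b
    simpa using hgX b
  · rw [Measure.map_apply hgmeas (h.isCompact_cylinder I).isClosed.measurableSet]
    rcases (g ⁻¹' cylinder φ X I).eq_empty_or_nonempty with h0 | ⟨b₀, hb₀⟩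
    · simp [h0]
    set N := I.length
    have hb₀I : pre (concatBlocks hn b₀) N = I := h.pre_eq_of_mem (hpt _) hb₀
    calc P (g ⁻¹' cylinder φ X I) ≤ P {b' | ∀ q < N / n, b' q = b₀ q} := by
          refine measure_mono fun b hb q hq => ?_
          have hbI : pre (concatBlocks hn b) N = I := h.pre_eq_of_mem (hpt _) hb
          exact eq_of_pre_concatBlocks_eq hn (hbI.trans hb₀I.symm) hq
      _ = _ := hPcyl _ _
      _ ≤ _ := ?_
    refine ENNReal.ofReal_le_ofReal ?_
    rw [← Real.mul_rpow (by positivity) (h.cdiam_pos I).le]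
    have h1 : ∏ q ∈ Finset.range (N / n), wt (b₀ q) / W ≤
        (∏ q ∈ Finset.range (N / n), cdiam φ X (List.ofFn (b₀ q).1) / C) ^ (t : ℝ) := by
      rw [← Real.finsetProd_rpow _ _ fun q _ => div_nonneg (h.cdiam_pos _).le hC.le]
      refine Finset.prod_le_prod (fun q _ => div_nonneg (hwt0 _) hW0.le) fun q _ => ?_
      exact div_le_self (hwt0 _) hW
    refine h1.trans (Real.rpow_le_rpow
      (Finset.prod_nonneg fun q _ => div_nonneg (h.cdiam_pos _).le hC.le) ?_ t.2)
    have h2 := h.prod_le_cdiam hn b₀ (N / n)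
    rw [← le_div_iff₀ hD] at h2
    refine h2.trans ?_
    have hsplit : I = pre (concatBlocks hn b₀) (n * (N / n)) ++
        pre (fun j => concatBlocks hn b₀ (n * (N / n) + j)) (N % n) := by
      rw [← pre_add, Nat.div_add_mod, hb₀I]
    have h3 := h.le_cdiam_append (pre (concatBlocks hn b₀) (n * (N / n)))
      (pre (fun j => concatBlocks hn b₀ (n * (N / n) + j)) (N % n))
    rw [← hsplit] at h3
    have h4 := hεle (pre (fun j => concatBlocks hn b₀ (n * (N / n) + j)) (N % n))
      (by simpa using (Nat.mod_lt N hn).le)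
    have h5 := (h.cdiam_pos (pre (concatBlocks hn b₀) (n * (N / n)))).le
    have h6 : cdiam φ X (pre (concatBlocks hn b₀) (n * (N / n))) * ε ≤ C * cdiam φ X I :=
      (mul_le_mul_of_nonneg_left h4 h5).trans h3
    rw [← le_div_iff₀ hε] at h6
    calc _ ≤ C * cdiam φ X I / ε / diam X := by gcongr
      _ = _ := by ring
  · have hsub : g ⁻¹' blockSet φ X hn 𝒥 = univ :=
      eq_univ_of_forall fun b => ⟨b, hpt _⟩
    -- An inequality suffices, so measurability of `blockSet` is not needed.
    have := Measure.le_map_apply hgmeas.aemeasurable (μ := P) (blockSet φ X hn 𝒥)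
    rw [hsub, measure_univ] at this
    exact (one_pos.trans_le this).ne'

end Blocks

/-! ### Positivity and finiteness of the Hausdorff measure. -/

lemma continuous_sum_rpow {κ : Type*} (A : Finset κ) {x : κ → ℝ} (hx : ∀ k, 0 < x k) :
    Continuous fun t : ℝ => ∑ k ∈ A, x k ^ t :=
  continuous_finsetSum _ fun k _ => Real.continuous_const_rpow (hx k).ne'

section Dimension

variable {ι E : Type*} [MetricSpace E] {φ : ι → E → E} {X : Set E} {C ρ : ℝ}

lemma blockSet_subset {E : Type*} (φ : ι → E → E) (X : Set E) {n : ℕ} (hn : 0 < n)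
    (𝒥 : Finset (Fin n → ι)) : blockSet φ X hn 𝒥 ⊆ X := by
  rintro x ⟨b, hb⟩
  simpa [cylinder_nil] using hb 0

namespace IsQuasiSimilar

lemma ediam_cylinder_rpow (h : IsQuasiSimilar φ X C ρ) (I : List ι) {t : ℝ} (ht : 0 ≤ t) :
    ediam (cylinder φ X I) ^ t = ENNReal.ofReal (cdiam φ X I ^ t) := by
  have := isBounded_iff_ediam_ne_top.1 (h.isBounded_cylinder I)
  rw [← ENNReal.ofReal_rpow_of_nonneg diam_nonneg ht, Metric.diam, ENNReal.ofReal_toReal this]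

lemma tendsto_ediam_bound (h : IsQuasiSimilar φ X C ρ) :
    Tendsto (fun n : ℕ => ENNReal.ofReal (ρ ^ n * diam X)) atTop (𝓝 0) := by
  have : Tendsto (fun n : ℕ => ρ ^ n * diam X) atTop (𝓝 0) := by
    simpa using (tendsto_pow_atTop_nhds_zero_of_lt_one h.rho_pos.le h.rho_lt).mul_const (diam X)
  simpa using ENNReal.tendsto_ofReal this

lemma ediam_cylinder_le (h : IsQuasiSimilar φ X C ρ) {I : List ι} {n : ℕ} (hI : n ≤ I.length) :
    ediam (cylinder φ X I) ≤ ENNReal.ofReal (ρ ^ n * diam X) := by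
  have := isBounded_iff_ediam_ne_top.1 (h.isBounded_cylinder I)
  rw [← ENNReal.ofReal_toReal this]
  refine ENNReal.ofReal_le_ofReal ((h.diam_le I).trans ?_)
  have := h.rho_pos.le
  gcongr ?_ * _
  exact pow_le_pow_of_le_one this h.rho_lt.le hI

/-- Cylinders are relatively open. -/
lemma exists_isOpen_inter_eq [Finite ι] (h : IsQuasiSimilar φ X C ρ) (I : List ι) :
    ∃ O : Set E, IsOpen O ∧ X ∩ O = cylinder φ X I := by
  refine ⟨(⋃ J : {J : Fin I.length → ι // List.ofFn J ≠ I}, cylinder φ X (List.ofFn J.1))ᶜ,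
    (isClosed_iUnion_of_finite fun J => (h.isCompact_cylinder _).isClosed).isOpen_compl, ?_⟩
  ext x
  constructor
  · rintro ⟨hxX, hx⟩
    obtain ⟨c, hc, -⟩ := h.exists_code
    by_contra hxI
    refine hx (mem_iUnion.2 ⟨⟨fun k => c x k, fun heq => hxI ?_⟩, hc x hxX _⟩)
    rw [← heq]
    exact hc x hxX I.length
  · refine fun hx => ⟨h.cylinder_subset I hx, fun hx' => ?_⟩
    obtain ⟨J, hJ⟩ := mem_iUnion.1 hx'
    exact J.2 (h.eq_of_mem_cylinder hJ hx (by simp))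

/-- The inverse of `φ_I` on the cylinder `X_I`. -/
lemma exists_lipschitz_inverse (h : IsQuasiSimilar φ X C ρ) (I : List ι) :
    ∃ g : E → E, LipschitzOnWith (C / cdiam φ X I).toNNReal g (cylinder φ X I) ∧
      ∀ x ∈ X, g (wordMap φ I x) = x := by
  have hC := h.C_pos
  have hD := h.cdiam_pos I
  have : Nonempty E := ⟨h.nonempty.some⟩
  have hg : ∀ x ∈ X, Function.invFunOn (wordMap φ I) X (wordMap φ I x) = x :=
    fun x hx => (h.injOn I).leftInvOn_invFunOn hx
  refine ⟨Function.invFunOn (wordMap φ I) X, LipschitzOnWith.of_dist_le_mul ?_, hg⟩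
  rintro _ ⟨x, hx, rfl⟩ _ ⟨y, hy, rfl⟩
  rw [hg x hx, hg y hy, Real.coe_toNNReal _ (by positivity), div_mul_eq_mul_div,
    le_div_iff₀' hD]
  exact h.lower I x hx y hy

lemma nontrivial_index (h : IsQuasiSimilar φ X C ρ) : Nontrivial ι := by
  by_contra hι
  rw [not_nontrivial_iff_subsingleton] at hι
  obtain ⟨i⟩ := h.nonempty_index
  have hX : X = cylinder φ X [i] := by
    conv_lhs => rw [h.eq_iUnion]
    refine subset_antisymm (iUnion_subset fun j => ?_) (subset_iUnion (fun j => φ j '' X) i)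
    rw [Subsingleton.elim j i]
    exact subset_rfl
  have h1 := h.diam_le [i]
  rw [← hX, List.length_singleton, pow_one] at h1
  nlinarith [h.diam_pos, h.rho_lt]

/-- Substituting the cover into its own cylinders `k` times gives covers by words of length at least
`k` whose `t`-sum decays like `κ ^ k`; the factor `C` in the hypothesis pays for each concatenation.
-/
lemma dimH_le_of_cover (h : IsQuasiSimilar φ X C ρ) {A : Finset (List ι)} (hA : ∀ I ∈ A, I ≠ [])
    (hcov : X ⊆ ⋃ I ∈ A, cylinder φ X I) {t : ℝ≥0}
    (hsum : ∑ I ∈ A, (C * cdiam φ X I) ^ (t : ℝ) < 1) : dimH X ≤ t := by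
  classical
  borelize E
  have hC := h.C_pos
  set κ := ∑ I ∈ A, (C * cdiam φ X I) ^ (t : ℝ) with hκ
  have hκ0 : 0 ≤ κ := Finset.sum_nonneg fun I _ => by positivity
  have hiter : ∀ k : ℕ, ∃ B : Finset (List ι), (∀ I ∈ B, k ≤ I.length) ∧
      X ⊆ ⋃ I ∈ B, cylinder φ X I ∧
      ∑ I ∈ B, cdiam φ X I ^ (t : ℝ) ≤ κ ^ k * diam X ^ (t : ℝ) := by
    intro k
    induction k with
    | zero => exact ⟨{[]}, by simp, by simp [cylinder_nil], by simp [cdiam, cylinder_nil]⟩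
    | succ k ih =>
      obtain ⟨B, hB, hBc, hBs⟩ := ih
      refine ⟨(B ×ˢ A).image fun p => p.1 ++ p.2, ?_, ?_, ?_⟩
      · simp only [Finset.mem_image, Finset.mem_product]
        rintro _ ⟨⟨I, J⟩, ⟨hI, hJ⟩, rfl⟩
        have h1 := hB I hI
        have h2 := List.length_pos_iff.2 (hA J hJ)
        simp only [List.length_append]
        omega
      · intro x hx
        obtain ⟨I, hI, y, hy, rfl⟩ := mem_iUnion₂.1 (hBc hx)
        obtain ⟨J, hJ, hyJ⟩ := mem_iUnion₂.1 (hcov hy)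
        refine mem_iUnion₂.2 ⟨I ++ J, Finset.mem_image.2
          ⟨(I, J), Finset.mem_product.2 ⟨hI, hJ⟩, rfl⟩, ?_⟩
        rw [cylinder_append]
        exact mem_image_of_mem _ hyJ
      · calc ∑ I ∈ (B ×ˢ A).image fun p => p.1 ++ p.2, cdiam φ X I ^ (t : ℝ)
            ≤ ∑ p ∈ B ×ˢ A, cdiam φ X (p.1 ++ p.2) ^ (t : ℝ) :=
              Finset.sum_image_le_of_nonneg fun _ _ => by positivity
          _ ≤ ∑ p ∈ B ×ˢ A, cdiam φ X p.1 ^ (t : ℝ) * (C * cdiam φ X p.2) ^ (t : ℝ) := by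
            refine Finset.sum_le_sum fun p _ => ?_
            rw [← Real.mul_rpow (h.cdiam_pos _).le (mul_nonneg hC.le (h.cdiam_pos _).le)]
            refine Real.rpow_le_rpow diam_nonneg ((h.cdiam_append_le _ _).trans (le_of_eq ?_)) t.2
            ring
          _ = (∑ I ∈ B, cdiam φ X I ^ (t : ℝ)) * κ := by
            rw [Finset.sum_product, hκ, Finset.sum_mul_sum]
          _ ≤ κ ^ k * diam X ^ (t : ℝ) * κ := by gcongr
          _ = _ := by ring
  choose B hBlen hBc hBs using hiter
  refine dimH_le_of_hausdorffMeasure_ne_top (ne_top_of_le_ne_top ENNReal.zero_ne_top ?_)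
  refine (Measure.hausdorffMeasure_le_liminf_sum (β := ℕ) (ι := fun n => B n) (l := atTop)
    (t : ℝ) X (fun n => ENNReal.ofReal (ρ ^ n * diam X)) h.tendsto_ediam_bound
    (fun n J => cylinder φ X J.1)
    (Eventually.of_forall fun n J => h.ediam_cylinder_le (hBlen n _ J.2))
    (Eventually.of_forall fun n => ?_)).trans ?_
  · intro x hx
    obtain ⟨I, hI, hxI⟩ := mem_iUnion₂.1 (hBc n hx)
    exact mem_iUnion.2 ⟨⟨I, hI⟩, hxI⟩
  · have hlim : Tendsto (fun n : ℕ => ENNReal.ofReal (κ ^ n * diam X ^ (t : ℝ))) atTop (𝓝 0) := by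
      have : Tendsto (fun n : ℕ => κ ^ n * diam X ^ (t : ℝ)) atTop (𝓝 0) := by
        simpa using (tendsto_pow_atTop_nhds_zero_of_lt_one hκ0 hsum).mul_const
          (diam X ^ (t : ℝ))
      simpa using ENNReal.tendsto_ofReal this
    rw [← hlim.liminf_eq]
    refine liminf_le_liminf (Eventually.of_forall fun n => ?_)
    simp only [h.ediam_cylinder_rpow _ t.coe_nonneg]
    rw [Finset.sum_coe_sort (B n) fun I => ENNReal.ofReal (cdiam φ X I ^ (t : ℝ)),
      ← ENNReal.ofReal_sum_of_nonneg fun J _ => by positivity]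
    exact ENNReal.ofReal_le_ofReal (hBs n)

variable [Fintype ι]

/-- At exponent `0` the block sum counts letters, of which there are at least two; by continuity it
stays above `1` for some positive exponent. -/
lemma dimH_pos (h : IsQuasiSimilar φ X C ρ) : 0 < dimH X := by
  have := h.nontrivial_index
  have hC := h.C_pos
  set f : ℝ → ℝ := fun t => ∑ J : Fin 1 → ι, (cdiam φ X (List.ofFn J) / C) ^ t with hf
  have hcont : Continuous f := continuous_sum_rpow _ fun J => div_pos (h.cdiam_pos _) hC
  have h0 : 1 < f 0 := by
    simp only [hf, Real.rpow_zero, Finset.sum_const, Finset.card_univ, nsmul_eq_mul, mul_one]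
    have : 1 < Fintype.card (Fin 1 → ι) := by
      rw [Fintype.card_fun]; simpa using Fintype.one_lt_card
    exact_mod_cast this
  have hev : ∀ᶠ t in 𝓝[>] (0 : ℝ), 1 < f t :=
    ((hcont.tendsto 0).mono_left nhdsWithin_le_nhds).eventually_const_lt h0
  obtain ⟨t, ht1, ht0⟩ := (hev.and self_mem_nhdsWithin).exists
  lift t to ℝ≥0 using le_of_lt ht0
  have h1 := h.le_dimH_blockSet one_pos (𝒥 := Finset.univ) (t := t) (by exact_mod_cast ht0) ht1.le
  refine lt_of_lt_of_le ?_ (h1.trans (dimH_mono (blockSet_subset _ _ _ _)))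
  exact_mod_cast ht0

/-- Otherwise the normalised sum would still exceed `1` at some exponent `t > s`, and the Bernoulli
measure on all blocks would force dimension at least `t`. -/
lemma sum_cdiam_rpow_le (h : IsQuasiSimilar φ X C ρ) (hfin : dimH X ≠ ∞) {n : ℕ} (hn : 0 < n) :
    ∑ J : Fin n → ι, cdiam φ X (List.ofFn J) ^ (dimH X).toReal ≤ C ^ (dimH X).toReal := by
  have hC := h.C_pos
  set s := (dimH X).toReal with hs
  by_contra! hlt
  set f : ℝ → ℝ := fun t => ∑ J : Fin n → ι, (cdiam φ X (List.ofFn J) / C) ^ t with hf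
  have hcont : Continuous f := continuous_sum_rpow _ fun J => div_pos (h.cdiam_pos _) hC
  have h0 : 1 < f s := by
    have hCs : 0 < C ^ s := Real.rpow_pos_of_pos hC s
    simp only [hf, Real.div_rpow (h.cdiam_pos _).le hC.le, ← Finset.sum_div]
    rwa [one_lt_div hCs]
  have hev : ∀ᶠ t in 𝓝[>] s, 1 < f t :=
    ((hcont.tendsto s).mono_left nhdsWithin_le_nhds).eventually_const_lt h0
  obtain ⟨t, ht1, hts⟩ := (hev.and self_mem_nhdsWithin).exists
  have hs0 : 0 ≤ s := ENNReal.toReal_nonneg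
  have ht0 : 0 < t := hs0.trans_lt hts
  lift t to ℝ≥0 using ht0.le
  have h1 := h.le_dimH_blockSet hn (𝒥 := Finset.univ) (t := t) (by exact_mod_cast ht0) ht1.le
  have h2 := ENNReal.toReal_mono hfin (h1.trans (dimH_mono (blockSet_subset _ _ _ _)))
  rw [ENNReal.coe_toReal] at h2
  exact absurd h2 (not_le.2 hts)

variable [MeasurableSpace E] [BorelSpace E]

lemma hausdorffMeasure_lt_top (h : IsQuasiSimilar φ X C ρ) (hfin : dimH X ≠ ∞) :
    Measure.hausdorffMeasure (dimH X).toReal X < ∞ := by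
  set s := (dimH X).toReal with hs
  have hs0 : 0 ≤ s := ENNReal.toReal_nonneg
  refine lt_of_le_of_lt (Measure.hausdorffMeasure_le_liminf_sum (β := ℕ)
    (ι := fun n => Fin (n + 1) → ι) (l := atTop) s X
    (fun n => ENNReal.ofReal (ρ ^ n * diam X)) h.tendsto_ediam_bound
    (fun n J => cylinder φ X (List.ofFn J)) (Eventually.of_forall fun n J => ?_)
    (Eventually.of_forall fun n => ?_))
    (lt_of_le_of_lt (b := ENNReal.ofReal (C ^ s)) ?_ ENNReal.ofReal_lt_top)
  · exact h.ediam_cylinder_le (by simp)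
  · have := h.cylinder_eq_iUnion [] (n + 1)
    rw [cylinder_nil] at this
    exact this.le
  · refine liminf_le_of_frequently_le' (Frequently.of_forall fun n => ?_)
    simp only [h.ediam_cylinder_rpow _ hs0]
    rw [← ENNReal.ofReal_sum_of_nonneg fun J _ => by positivity]
    exact ENNReal.ofReal_le_ofReal (h.sum_cdiam_rpow_le hfin n.succ_pos)

/-- A cheap countable cover is replaced by comparable cylinders, which are relatively open in the
compact set `X`, so finitely many suffice. -/
lemma exists_cover_of_hausdorffMeasure_eq_zero (h : IsQuasiSimilar φ X C ρ) {s : ℝ} (hs : 0 < s)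
    (h0 : Measure.hausdorffMeasure s X = 0) :
    ∃ A : Finset (List ι), (∀ I ∈ A, I ≠ []) ∧ X ⊆ ⋃ I ∈ A, cylinder φ X I ∧
      ∑ I ∈ A, (C * cdiam φ X I) ^ s < 1 := by
  classical
  have hC := h.C_pos
  obtain ⟨δ, hδ, B, hB, hsup⟩ := h.exists_cylinder_superset
  set k := (C * B) ^ s with hk
  have hk0 : 0 < k := by positivity
  rw [Measure.hausdorffMeasure_apply] at h0
  -- Covering sets of diameter below `δ` produce nonempty words. The budget `1` is split evenly
  -- between the cover and the errors `e n`.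
  have h1 := ENNReal.iSup_eq_zero.1 (ENNReal.iSup_eq_zero.1 h0 (ENNReal.ofReal (δ / 2)))
    (ENNReal.ofReal_pos.2 (by positivity))
  have h2 : _ < ENNReal.ofReal (1 / (2 * k)) :=
    h1.trans_lt (ENNReal.ofReal_pos.2 (by positivity))
  simp only [iInf_lt_iff] at h2
  obtain ⟨U, hUX, hUd, hUsum⟩ := h2
  have hUtop : ∀ n, ediam (U n) ≠ ∞ := fun n => ne_top_of_le_ne_top ENNReal.ofReal_ne_top (hUd n)
  have hUb : ∀ n, Bornology.IsBounded (U n) := fun n => isBounded_iff_ediam_ne_top.2 (hUtop n)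
  have hUδ : ∀ n, diam (U n) < δ := fun n => by
    have := ENNReal.toReal_mono ENNReal.ofReal_ne_top (hUd n)
    rw [ENNReal.toReal_ofReal (by positivity)] at this
    exact this.trans_lt (by linarith)
  obtain ⟨e, he0, hesum⟩ := ENNReal.exists_pos_sum_of_countable
    (ε := ENNReal.ofReal (1 / 2)) (ENNReal.ofReal_pos.2 (by positivity)).ne' ℕ
  have hchoice : ∀ n, ∃ I : List ι, U n ∩ X ⊆ cylinder φ X I ∧ I ≠ [] ∧
      (C * cdiam φ X I) ^ s ≤ k * diam (U n) ^ s + e n := by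
    intro n
    have hcont : Continuous fun η : ℝ => (C * (B * diam (U n) + η)) ^ s :=
      (continuous_const.mul (continuous_const.add continuous_id)).rpow_const
        fun _ => Or.inr hs.le
    have hlt : (C * (B * diam (U n) + 0)) ^ s < k * diam (U n) ^ s + e n := by
      rw [add_zero, ← mul_assoc, Real.mul_rpow (by positivity) diam_nonneg]
      have : (0 : ℝ) < e n := he0 n
      linarith
    have hev : ∀ᶠ η in 𝓝[>] (0 : ℝ), (C * (B * diam (U n) + η)) ^ s < k * diam (U n) ^ s + e n :=
      ((hcont.tendsto 0).mono_left nhdsWithin_le_nhds).eventually_lt_const hlt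
    obtain ⟨η, hη, hη0⟩ := (hev.and self_mem_nhdsWithin).exists
    obtain ⟨I, hI, hD, hne⟩ := hsup (U n) (hUb n) η hη0
    refine ⟨I, hI, hne (hUδ n), le_trans ?_ hη.le⟩
    gcongr
  choose I hIU hIne hIs using hchoice
  choose O hO hXO using fun n => h.exists_isOpen_inter_eq (I n)
  obtain ⟨F, hF⟩ := h.isCompact.elim_finite_subcover O hO fun x hx => by
    obtain ⟨n, hn⟩ := mem_iUnion.1 (hUX hx)
    have hmem := hIU n ⟨hn, hx⟩
    rw [← hXO n] at hmem
    exact mem_iUnion.2 ⟨n, hmem.2⟩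
  refine ⟨F.image I, ?_, ?_, ?_⟩
  · simp only [Finset.mem_image]
    rintro _ ⟨n, -, rfl⟩
    exact hIne n
  · intro x hx
    obtain ⟨n, hn, hxn⟩ := mem_iUnion₂.1 (hF hx)
    refine mem_iUnion₂.2 ⟨I n, Finset.mem_image_of_mem _ hn, ?_⟩
    rw [← hXO n]
    exact ⟨hx, hxn⟩
  · refine (Finset.sum_image_le_of_nonneg fun _ _ => by
      have := (h.cdiam_pos (φ := φ)); positivity).trans_lt ?_
    rw [← ENNReal.ofReal_lt_one, ENNReal.ofReal_sum_of_nonneg fun _ _ => by positivity]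
    calc ∑ n ∈ F, ENNReal.ofReal ((C * cdiam φ X (I n)) ^ s)
        ≤ ∑ n ∈ F, (ENNReal.ofReal k * (⨆ _ : (U n).Nonempty, ediam (U n) ^ s) + e n) := by
          refine Finset.sum_le_sum fun n _ => (ENNReal.ofReal_le_ofReal (hIs n)).trans ?_
          rw [ENNReal.ofReal_add (by positivity) (e n).coe_nonneg, ENNReal.ofReal_coe_nnreal,
            ENNReal.ofReal_mul hk0.le, ← ENNReal.ofReal_rpow_of_nonneg diam_nonneg hs.le,
            Metric.diam, ENNReal.ofReal_toReal (hUtop n)]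
          gcongr
          rcases (U n).eq_empty_or_nonempty with hU0 | hU0
          · simp [hU0, hs]
          · exact le_iSup (fun _ : (U n).Nonempty => ediam (U n) ^ s) hU0
      _ ≤ ∑' n, (ENNReal.ofReal k * (⨆ _ : (U n).Nonempty, ediam (U n) ^ s) + e n) :=
          ENNReal.sum_le_tsum _
      _ = ENNReal.ofReal k * (∑' n, ⨆ _ : (U n).Nonempty, ediam (U n) ^ s) + ∑' n, (e n : ℝ≥0∞) := by
          rw [ENNReal.tsum_add, ENNReal.tsum_mul_left]
      _ < ENNReal.ofReal (1 / 2) + ENNReal.ofReal (1 / 2) := by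
          refine ENNReal.add_lt_add ?_ hesum
          have := (ENNReal.mul_lt_mul_iff_right (ENNReal.ofReal_pos.2 hk0).ne'
            ENNReal.ofReal_ne_top).2 hUsum
          refine this.trans_eq ?_
          rw [← ENNReal.ofReal_mul hk0.le]
          congr 1
          field_simp
      _ = 1 := by
          rw [← ENNReal.ofReal_add (by norm_num) (by norm_num)]; norm_num

/-- For zero measure, a finite cylinder cover has sum below `1` at `s`, hence also at some `t < s`;
iterating it gives dimension at most `t`. -/
lemma hausdorffMeasure_pos (h : IsQuasiSimilar φ X C ρ) (hfin : dimH X ≠ ∞) :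
    0 < Measure.hausdorffMeasure (dimH X).toReal X := by
  have hC := h.C_pos
  set s := (dimH X).toReal with hs
  have hs0 : 0 < s := ENNReal.toReal_pos h.dimH_pos.ne' hfin
  refine pos_iff_ne_zero.2 fun h0 => ?_
  obtain ⟨A, hA, hcov, hsum⟩ := h.exists_cover_of_hausdorffMeasure_eq_zero hs0 h0
  have hcont : Continuous fun t : ℝ => ∑ I ∈ A, (C * cdiam φ X I) ^ t :=
    continuous_sum_rpow _ fun I => mul_pos hC (h.cdiam_pos I)
  have hev : ∀ᶠ t in 𝓝[<] s, ∑ I ∈ A, (C * cdiam φ X I) ^ t < 1 :=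
    ((hcont.tendsto s).mono_left nhdsWithin_le_nhds).eventually_lt_const hsum
  have hev' : ∀ᶠ t in 𝓝[<] s, 0 < t := nhdsWithin_le_nhds (lt_mem_nhds hs0)
  obtain ⟨t, ⟨ht1, ht0⟩, hts⟩ := ((hev.and hev').and self_mem_nhdsWithin).exists
  lift t to ℝ≥0 using ht0.le
  have h1 := ENNReal.toReal_mono ENNReal.coe_ne_top (h.dimH_le_of_cover hA hcov ht1)
  rw [ENNReal.coe_toReal] at h1
  exact absurd h1 (not_le.2 hts)

/-- The Hausdorff measure of a cylinder is comparable to a power of its diameter. -/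
theorem exists_measure_cylinder (h : IsQuasiSimilar φ X C ρ) (hfin : dimH X ≠ ∞) :
    ∃ A : ℝ, 0 < A ∧ ∀ I : List ι,
      (Measure.hausdorffMeasure (dimH X).toReal).real (cylinder φ X I) ≤
        A * cdiam φ X I ^ (dimH X).toReal ∧
      cdiam φ X I ^ (dimH X).toReal ≤
        A * (Measure.hausdorffMeasure (dimH X).toReal).real (cylinder φ X I) := by
  have hC := h.C_pos
  have htop := h.hausdorffMeasure_lt_top hfin
  have hpos := h.hausdorffMeasure_pos hfin
  set s := (dimH X).toReal with hs
  have hs0 : 0 ≤ s := ENNReal.toReal_nonneg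
  set μ : Measure E := Measure.hausdorffMeasure s with hμ
  set M := μ.real X with hM
  have hM0 : 0 < M := ENNReal.toReal_pos hpos.ne' htop.ne
  have hcyltop : ∀ I, μ (cylinder φ X I) ≠ ∞ := fun I =>
    ne_top_of_le_ne_top htop.ne (measure_mono (h.cylinder_subset I))
  refine ⟨C ^ s * M + C ^ s / M, by positivity, fun I => ?_⟩
  have hD := h.cdiam_pos I
  constructor
  · have hL : LipschitzOnWith (C * cdiam φ X I).toNNReal (wordMap φ I) X :=
      LipschitzOnWith.of_dist_le_mul fun x hx y hy => by
        rw [Real.coe_toNNReal _ (by positivity)]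
        exact h.upper I x hx y hy
    have h1 : μ (cylinder φ X I) ≤ _ := hL.hausdorffMeasure_image_le hs0
    have h2 := ENNReal.toReal_mono (ENNReal.mul_ne_top
      (ENNReal.rpow_ne_top_of_nonneg hs0 ENNReal.coe_ne_top) htop.ne) h1
    rw [ENNReal.toReal_mul, ← ENNReal.toReal_rpow, ENNReal.coe_toReal,
      Real.coe_toNNReal _ (by positivity), Real.mul_rpow hC.le hD.le] at h2
    refine h2.trans ?_
    have h3 : 0 ≤ C ^ s / M * cdiam φ X I ^ s := by positivity
    change C ^ s * cdiam φ X I ^ s * M ≤ _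
    linarith
  · obtain ⟨g, hg, hgx⟩ := h.exists_lipschitz_inverse I
    have himg : g '' cylinder φ X I = X := by
      rw [cylinder, ← image_comp]
      exact (image_congr fun x hx => hgx x hx).trans (image_id X)
    have h1 := hg.hausdorffMeasure_image_le hs0
    rw [himg] at h1
    have h2 := ENNReal.toReal_mono (ENNReal.mul_ne_top
      (ENNReal.rpow_ne_top_of_nonneg hs0 ENNReal.coe_ne_top) (hcyltop I)) h1
    rw [ENNReal.toReal_mul, ← ENNReal.toReal_rpow, ENNReal.coe_toReal,
      Real.coe_toNNReal _ (by positivity), Real.div_rpow hC.le hD.le] at h2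
    change M ≤ C ^ s / cdiam φ X I ^ s * μ.real (cylinder φ X I) at h2
    have hDs : 0 < cdiam φ X I ^ s := by positivity
    rw [div_mul_eq_mul_div, le_div_iff₀ hDs] at h2
    have h3 : 0 ≤ C ^ s * M * μ.real (cylinder φ X I) := by positivity
    have h4 : cdiam φ X I ^ s ≤ C ^ s / M * μ.real (cylinder φ X I) := by
      rw [div_mul_eq_mul_div, le_div_iff₀' hM0]
      exact h2
    linarith

end IsQuasiSimilar

end Dimension

/-! ### A second moment inequality. -/

section SecondMoment

/-- With `f` the number of sets containing a point, `2bf - b²f² ≤ 1` because `(1 - bf)² ≥ 0`, and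
the left side vanishes off the union; integrate. The free `b` is optimised by the user. -/
lemma le_measureReal_biUnion {Ω α : Type*} [MeasurableSpace Ω] (μ : Measure Ω)
    [IsFiniteMeasure μ] (T : Finset α) {F : α → Set Ω} (hF : ∀ n ∈ T, MeasurableSet (F n))
    (b : ℝ) :
    2 * b * ∑ n ∈ T, μ.real (F n) - b ^ 2 * ∑ n ∈ T, ∑ m ∈ T, μ.real (F n ∩ F m) ≤
      μ.real (⋃ n ∈ T, F n) := by
  have hU : MeasurableSet (⋃ n ∈ T, F n) := T.measurableSet_biUnion hF
  set f : Ω → ℝ := fun ω => ∑ n ∈ T, (F n).indicator 1 ω with hf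
  have hint : ∀ A : Set Ω, MeasurableSet A → Integrable (A.indicator (1 : Ω → ℝ)) μ := fun A hA =>
    (integrable_const (1 : ℝ)).indicator hA
  have hsq : ∀ ω, f ω ^ 2 = ∑ n ∈ T, ∑ m ∈ T, (F n ∩ F m).indicator (1 : Ω → ℝ) ω := by
    intro ω
    rw [hf, sq, Finset.sum_mul_sum]
    refine Finset.sum_congr rfl fun n _ => Finset.sum_congr rfl fun m _ => ?_
    rw [inter_indicator_one]
    rfl
  have h1 : ∫ ω, f ω ∂μ = ∑ n ∈ T, μ.real (F n) := by
    rw [hf, integral_finsetSum _ fun n hn => hint _ (hF n hn)]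
    exact Finset.sum_congr rfl fun n hn => integral_indicator_one (hF n hn)
  have h2 : ∫ ω, f ω ^ 2 ∂μ = ∑ n ∈ T, ∑ m ∈ T, μ.real (F n ∩ F m) := by
    simp only [hsq]
    rw [integral_finsetSum _ fun n hn => integrable_finsetSum _ fun m hm =>
      hint _ ((hF n hn).inter (hF m hm))]
    refine Finset.sum_congr rfl fun n hn => ?_
    rw [integral_finsetSum _ fun m hm => hint _ ((hF n hn).inter (hF m hm))]
    exact Finset.sum_congr rfl fun m hm => integral_indicator_one ((hF n hn).inter (hF m hm))
  have hfi : Integrable f μ := integrable_finsetSum _ fun n hn => hint _ (hF n hn)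
  have hfi2 : Integrable (fun ω => f ω ^ 2) μ := by
    simp only [hsq]
    exact integrable_finsetSum _ fun n hn => integrable_finsetSum _ fun m hm =>
      hint _ ((hF n hn).inter (hF m hm))
  have h3 : ∫ ω, (2 * b * f ω - b ^ 2 * f ω ^ 2) ∂μ ≤
      ∫ ω, (⋃ n ∈ T, F n).indicator (1 : Ω → ℝ) ω ∂μ := by
    refine integral_mono ((hfi.const_mul _).sub (hfi2.const_mul _)) (hint _ hU) fun ω => ?_
    by_cases hω : ω ∈ ⋃ n ∈ T, F n
    · simp only [indicator_of_mem hω, Pi.one_apply]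
      nlinarith [sq_nonneg (1 - b * f ω)]
    · have : f ω = 0 := Finset.sum_eq_zero fun n hn =>
        indicator_of_notMem (fun h => hω (mem_iUnion₂.2 ⟨n, hn, h⟩)) _
      simp [indicator_of_notMem hω, this]
  rwa [integral_sub (hfi.const_mul _) (hfi2.const_mul _), integral_const_mul, integral_const_mul,
    h1, h2, integral_indicator_one hU] at h3

end SecondMoment

lemma exists_finset_one_le_sum {A : Set ℕ} {a : ℕ → ℝ} (ha : ∀ n, 0 ≤ a n)
    (hA : ¬ Summable (A.indicator a)) (N : ℕ) :
    ∃ T : Finset ℕ, (∀ n ∈ T, n ∈ A ∧ N ≤ n) ∧ 1 ≤ ∑ n ∈ T, a n := by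
  classical
  have h1 : ¬ Summable fun n => A.indicator a (n + N) := fun hs => hA ((summable_nat_add_iff N).1 hs)
  have h2 := (not_summable_iff_tendsto_nat_atTop_of_nonneg
    fun n => indicator_nonneg (fun k _ => ha k) _).1 h1
  obtain ⟨n, hn⟩ := (h2.eventually_ge_atTop 1).exists
  refine ⟨(Finset.Ico N (N + n)).filter (· ∈ A), fun m hm => ?_, ?_⟩
  · simp only [Finset.mem_filter, Finset.mem_Ico] at hm
    exact ⟨hm.2, hm.1.1⟩
  · rw [Finset.sum_filter, Finset.sum_Ico_eq_sum_range, Nat.add_sub_cancel_left]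
    refine hn.trans (le_of_eq (Finset.sum_congr rfl fun i _ => ?_))
    rw [add_comm, indicator_apply]

/-! ### Quasi-Bernoulli measures and appearances of initial words. -/

section Symbolic

variable {Ω ι : Type*}

/-- The set of points whose code starts with the word `I`. -/
def codeCylinder (c : Ω → ℕ → ι) (I : List ι) : Set Ω := {ω | pre (c ω) I.length = I}

/-- The set `A` depends on the first `m` letters of the code only. -/
def DependsOnFirst (c : Ω → ℕ → ι) (m : ℕ) (A : Set Ω) : Prop :=
  ∀ ω ω', pre (c ω) m = pre (c ω') m → ω ∈ A → ω' ∈ A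

/-- The set of points in whose code the first `p` letters of `z` appear at the place `n`. -/
def appears (c : Ω → ℕ → ι) (z : ℕ → ι) (n p : ℕ) : Set Ω := {ω | ∀ j < p, c ω (n + j) = z j}

lemma DependsOnFirst.mono {c : Ω → ℕ → ι} {m m' : ℕ} {A : Set Ω} (h : DependsOnFirst c m A)
    (hm : m ≤ m') : DependsOnFirst c m' A := fun ω ω' he =>
  h ω ω' (pre_eq_iff.2 fun j hj => pre_eq_iff.1 he j (hj.trans_le hm))

lemma DependsOnFirst.inter {c : Ω → ℕ → ι} {m : ℕ} {A B : Set Ω} (hA : DependsOnFirst c m A)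
    (hB : DependsOnFirst c m B) : DependsOnFirst c m (A ∩ B) := fun ω ω' he h =>
  ⟨hA ω ω' he h.1, hB ω ω' he h.2⟩

lemma dependsOnFirst_codeCylinder (c : Ω → ℕ → ι) (I : List ι) :
    DependsOnFirst c I.length (codeCylinder c I) := fun _ _ he h => he.symm.trans h

lemma dependsOnFirst_appears (c : Ω → ℕ → ι) (z : ℕ → ι) (n p : ℕ) :
    DependsOnFirst c (n + p) (appears c z n p) := fun ω ω' he h j hj => by
  rw [← pre_eq_iff.1 he (n + j) (by omega)]
  exact h j hj

lemma codeCylinder_inter_appears (c : Ω → ℕ → ι) (z : ℕ → ι) (I : List ι) (p : ℕ) :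
    codeCylinder c I ∩ appears c z I.length p = codeCylinder c (I ++ pre z p) := by
  ext ω
  simp only [codeCylinder, appears, mem_inter_iff, mem_ofPred_eq, List.length_append, length_pre]
  rw [pre_add]
  constructor
  · rintro ⟨h1, h2⟩
    rw [h1, pre_eq_iff.2 h2]
  · intro h
    obtain ⟨h1, h2⟩ := List.append_inj h (by simp)
    exact ⟨h1, pre_eq_iff.1 h2⟩

open Classical in
/-- The words of length `m` that occur at the beginning of the code of a point of `A`. -/
noncomputable def prefixes [Fintype ι] (c : Ω → ℕ → ι) (m : ℕ) (A : Set Ω) :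
    Finset (Fin m → ι) :=
  Finset.univ.filter fun I => ∃ ω ∈ A, pre (c ω) m = List.ofFn I

lemma DependsOnFirst.eq_biUnion [Fintype ι] {c : Ω → ℕ → ι} {m : ℕ} {A : Set Ω}
    (hA : DependsOnFirst c m A) : A = ⋃ I ∈ prefixes c m A, codeCylinder c (List.ofFn I) := by
  ext ω
  simp only [prefixes, Finset.mem_filter, Finset.mem_univ, true_and, mem_iUnion, exists_prop,
    codeCylinder, mem_ofPred_eq, List.length_ofFn]
  constructor
  · exact fun h => ⟨fun k => c ω k, ⟨ω, h, rfl⟩, rfl⟩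
  · rintro ⟨I, ⟨ω', hω', he⟩, he'⟩
    exact hA ω' ω (he.trans he'.symm) hω'

variable [MeasurableSpace Ω]

/-- A finite measure on a coded space that is quasi-multiplicative on cylinders. -/
structure IsQuasiBernoulli (μ : Measure Ω) (c : Ω → ℕ → ι) (Q : ℝ) : Prop where
  measurableSet : ∀ n i, MeasurableSet {ω | c ω n = i}
  one_le : 1 ≤ Q
  pos : ∀ I, 0 < μ.real (codeCylinder c I)
  append_le : ∀ I J, μ.real (codeCylinder c (I ++ J)) ≤
    Q * (μ.real (codeCylinder c I) * μ.real (codeCylinder c J))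
  le_append : ∀ I J, μ.real (codeCylinder c I) * μ.real (codeCylinder c J) ≤
    Q * μ.real (codeCylinder c (I ++ J))

namespace IsQuasiBernoulli

variable {μ : Measure Ω} {c : Ω → ℕ → ι} {Q : ℝ}

lemma measurableSet_codeCylinder (h : IsQuasiBernoulli μ c Q) (I : List ι) :
    MeasurableSet (codeCylinder c I) := by
  have : codeCylinder c I = ⋂ k : Fin I.length, {ω | c ω k = I.get k} := by
    ext ω
    simp only [codeCylinder, mem_ofPred_eq, mem_iInter]
    conv_lhs => rw [← List.ofFn_get I]
    rw [pre]
    constructor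
    · intro he k
      have h1 := List.ext_getElem_iff.1 he
      simpa using h1.2 k (by simp) (by simp)
    · intro he
      refine List.ext_getElem (by simp) fun k h1 h2 => ?_
      simpa using he ⟨k, by simpa using h2⟩
  rw [this]
  exact MeasurableSet.iInter fun k => h.measurableSet _ _

variable [Fintype ι]

lemma measurableSet_of_dependsOnFirst (h : IsQuasiBernoulli μ c Q) {m : ℕ} {A : Set Ω}
    (hA : DependsOnFirst c m A) : MeasurableSet A := by
  rw [hA.eq_biUnion]
  exact Finset.measurableSet_biUnion _ fun I _ => h.measurableSet_codeCylinder _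

/-- Only finitely many words have length at most `l`, so adding up to `l` letters costs a bounded
factor. This absorbs the short overlaps of two appearances. -/
lemma exists_pre_le (h : IsQuasiBernoulli μ c Q) (z : ℕ → ι) (l : ℕ) :
    ∃ R > 0, ∀ p k, p ≤ k → k ≤ p + l →
      μ.real (codeCylinder c (pre z p)) ≤ R * μ.real (codeCylinder c (pre z k)) := by
  have : Finite {I : List ι // I.length ≤ l} := List.finite_length_le ι l
  obtain ⟨ε, hε, hle⟩ := exists_pos_forall_le_of_finite
    (f := fun I : {I : List ι // I.length ≤ l} => μ.real (codeCylinder c I.1)) fun I => h.pos I.1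
  have hQ : 0 < Q := one_pos.trans_le h.one_le
  refine ⟨Q / ε, by positivity, fun p k hpk hkp => ?_⟩
  obtain ⟨r, rfl⟩ := Nat.exists_eq_add_of_le hpk
  have h1 := h.le_append (pre z p) (pre (fun j => z (p + j)) r)
  rw [← pre_add] at h1
  have h2 := hle ⟨pre (fun j => z (p + j)) r, by simp; omega⟩
  rw [div_mul_eq_mul_div, le_div_iff₀ hε]
  exact (mul_le_mul_of_nonneg_left h2 (h.pos _).le).trans h1

variable [IsFiniteMeasure μ]

lemma measureReal_inter_eq_sum (h : IsQuasiBernoulli μ c Q) {m : ℕ} {A G : Set Ω}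
    (hA : DependsOnFirst c m A) (hG : MeasurableSet G) :
    μ.real (A ∩ G) = ∑ I ∈ prefixes c m A, μ.real (codeCylinder c (List.ofFn I) ∩ G) := by
  conv_lhs => rw [hA.eq_biUnion, iUnion₂_inter]
  refine measureReal_biUnion_finset (fun I _ J _ hIJ => ?_) fun I _ =>
    (h.measurableSet_codeCylinder _).inter hG
  refine disjoint_left.2 fun ω h1 h2 => hIJ (List.ofFn_injective ?_)
  have e1 : pre (c ω) _ = _ := h1.1
  have e2 : pre (c ω) _ = _ := h2.1
  rw [List.length_ofFn] at e1 e2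
  exact e1.symm.trans e2

lemma measureReal_eq_sum (h : IsQuasiBernoulli μ c Q) {m : ℕ} {A : Set Ω}
    (hA : DependsOnFirst c m A) :
    μ.real A = ∑ I ∈ prefixes c m A, μ.real (codeCylinder c (List.ofFn I)) := by
  simpa using h.measureReal_inter_eq_sum hA MeasurableSet.univ

lemma measureReal_inter_appears_le (h : IsQuasiBernoulli μ c Q) {m : ℕ} {A : Set Ω}
    (hA : DependsOnFirst c m A) (z : ℕ → ι) (p : ℕ) :
    μ.real (A ∩ appears c z m p) ≤ Q * (μ.real A * μ.real (codeCylinder c (pre z p))) := by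
  rw [h.measureReal_inter_eq_sum hA (h.measurableSet_of_dependsOnFirst
    (dependsOnFirst_appears c z m p)), h.measureReal_eq_sum hA, Finset.sum_mul, Finset.mul_sum]
  refine Finset.sum_le_sum fun I _ => ?_
  have := codeCylinder_inter_appears c z (List.ofFn I) p
  rw [List.length_ofFn] at this
  rw [this]
  exact h.append_le _ _

lemma le_measureReal_inter_appears (h : IsQuasiBernoulli μ c Q) {m : ℕ} {A : Set Ω}
    (hA : DependsOnFirst c m A) (z : ℕ → ι) (p : ℕ) :
    μ.real A * μ.real (codeCylinder c (pre z p)) ≤ Q * μ.real (A ∩ appears c z m p) := by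
  rw [h.measureReal_inter_eq_sum hA (h.measurableSet_of_dependsOnFirst
    (dependsOnFirst_appears c z m p)), h.measureReal_eq_sum hA, Finset.sum_mul, Finset.mul_sum]
  refine Finset.sum_le_sum fun I _ => ?_
  have := codeCylinder_inter_appears c z (List.ofFn I) p
  rw [List.length_ofFn] at this
  rw [this]
  exact h.le_append _ _

/-- Quasi-independence of the appearances of initial words of `z` at separated places. -/
lemma measureReal_inter_le (h : IsQuasiBernoulli μ c Q) {z : ℕ → ι} {l L : ℕ}
    (hz : ∀ k, L < k → ¬ ∀ j < l, z (k + j) = z j) {R : ℝ} (hR0 : 0 < R)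
    (hR : ∀ p k, p ≤ k → k ≤ p + l →
      μ.real (codeCylinder c (pre z p)) ≤ R * μ.real (codeCylinder c (pre z k)))
    {k : ℕ → ℕ} (hk : ∀ n, l ≤ k n) (J : List ι) {n m : ℕ} (hJ : J.length ≤ n)
    (hnm : n + L < m) :
    μ.real (codeCylinder c J ∩ (appears c z n (k n) ∩ appears c z m (k m))) ≤
      Q ^ 2 * R * μ.real (codeCylinder c J) * (μ.real (codeCylinder c (pre z (k n))) *
        μ.real (codeCylinder c (pre z (k m)))) := by
  have hQ : 0 < Q := one_pos.trans_le h.one_le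
  by_cases hcase : m + l ≤ n + k n
  -- An overlap of at least `l` letters would make the first `l` letters of `z` recur in `z` at
  -- place `m - n > L`.
  · have : codeCylinder c J ∩ (appears c z n (k n) ∩ appears c z m (k m)) = ∅ := by
      refine eq_empty_of_forall_notMem fun ω hω => hz (m - n) (by omega) fun j hj => ?_
      rw [← hω.2.1 (m - n + j) (by omega), ← hω.2.2 j (hj.trans_le (hk m))]
      congr 1
      omega
    rw [this, measureReal_empty]
    positivity
  -- The first appearance is cut off at place `m`, losing at most `l` letters; the two conditions
  -- then concern disjoint stretches of the code.
  · set p := min (k n) (m - n) with hp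
    have hA : DependsOnFirst c n (codeCylinder c J) :=
      (dependsOnFirst_codeCylinder c J).mono hJ
    have hA' : DependsOnFirst c m (codeCylinder c J ∩ appears c z n p) :=
      (hA.mono (by omega)).inter ((dependsOnFirst_appears c z n p).mono (by omega))
    have h1 := h.measureReal_inter_appears_le hA' z (k m)
    have h2 := h.measureReal_inter_appears_le hA z p
    have h3 := hR p (k n) (by omega) (by omega)
    have q1 := (h.pos J).le
    have q2 := (h.pos (pre z (k m))).le
    calc μ.real (codeCylinder c J ∩ (appears c z n (k n) ∩ appears c z m (k m)))
        ≤ μ.real (codeCylinder c J ∩ appears c z n p ∩ appears c z m (k m)) := by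
          refine measureReal_mono ?_
          rintro ω ⟨hω1, hω2, hω3⟩
          exact ⟨⟨hω1, fun j hj => hω2 j (by omega)⟩, hω3⟩
      _ ≤ Q * (Q * (μ.real (codeCylinder c J) * (R * μ.real (codeCylinder c (pre z (k n))))) *
          μ.real (codeCylinder c (pre z (k m)))) := by
          refine h1.trans ?_
          gcongr
          refine h2.trans ?_
          gcongr
      _ = _ := by ring

/-- The appearances of initial words of `z` at a separated set of places whose measures add up to
at least `1` cover a fixed proportion of every cylinder. -/
lemma exists_proportion (h : IsQuasiBernoulli μ c Q) {z : ℕ → ι} {l L : ℕ}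
    (hz : ∀ k, L < k → ¬ ∀ j < l, z (k + j) = z j) {k : ℕ → ℕ} (hk : ∀ n, l ≤ k n) :
    ∃ η > 0, ∀ (J : List ι) (T : Finset ℕ), (∀ n ∈ T, J.length ≤ n) →
      (∀ n ∈ T, ∀ m ∈ T, n < m → n + L < m) →
      1 ≤ ∑ n ∈ T, μ.real (codeCylinder c (pre z (k n))) →
      η * μ.real (codeCylinder c J) ≤
        μ.real (codeCylinder c J ∩ ⋃ n ∈ T, appears c z n (k n)) := by
  have hQ : 0 < Q := one_pos.trans_le h.one_le
  obtain ⟨R, hR0, hR⟩ := h.exists_pre_le z l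
  refine ⟨1 / (Q ^ 2 * (Q + Q ^ 2 * R)), by positivity, fun J T hJ hT hS => ?_⟩
  set q := μ.real (codeCylinder c J) with hq
  have hq0 : 0 < q := h.pos J
  set a : ℕ → ℝ := fun n => μ.real (codeCylinder c (pre z (k n))) with ha
  have ha0 : ∀ n, 0 ≤ a n := fun n => (h.pos _).le
  set S := ∑ n ∈ T, a n with hSdef
  have hS0 : 0 < S := one_pos.trans_le hS
  set G : ℕ → Set Ω := fun n => codeCylinder c J ∩ appears c z n (k n) with hG
  have hGm : ∀ n ∈ T, MeasurableSet (G n) := fun n _ => (h.measurableSet_codeCylinder J).inter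
    (h.measurableSet_of_dependsOnFirst (dependsOnFirst_appears c z n (k n)))
  have hAJ : ∀ n ∈ T, DependsOnFirst c n (codeCylinder c J) := fun n hn =>
    (dependsOnFirst_codeCylinder c J).mono (hJ n hn)
  have h1 : q * S / Q ≤ ∑ n ∈ T, μ.real (G n) := by
    rw [hSdef, Finset.mul_sum, Finset.sum_div]
    refine Finset.sum_le_sum fun n hn => ?_
    rw [div_le_iff₀' hQ]
    exact h.le_measureReal_inter_appears (hAJ n hn) z (k n)
  have h2 : ∑ n ∈ T, ∑ m ∈ T, μ.real (G n ∩ G m) ≤ Q * q * S + Q ^ 2 * R * q * S ^ 2 := by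
    have hb : ∀ n ∈ T, ∀ m ∈ T, μ.real (G n ∩ G m) ≤
        (if n = m then Q * q * a n else 0) + Q ^ 2 * R * q * (a n * a m) := by
      intro n hn m hm
      have hnn : 0 ≤ Q ^ 2 * R * q * (a n * a m) := by
        have := ha0 n; have := ha0 m; positivity
      rcases lt_trichotomy n m with hlt | rfl | hlt
      · rw [if_neg hlt.ne, zero_add, hG, ← inter_inter_distrib_left]
        exact h.measureReal_inter_le hz hR0 hR hk J (hJ n hn) (hT n hn m hm hlt)
      · rw [if_pos rfl, inter_self]
        have := h.measureReal_inter_appears_le (hAJ n hn) z (k n)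
        rw [← mul_assoc] at this
        linarith
      · rw [if_neg hlt.ne', zero_add, inter_comm, hG, ← inter_inter_distrib_left, mul_comm (a n)]
        exact h.measureReal_inter_le hz hR0 hR hk J (hJ m hm) (hT m hm n hn hlt)
    refine (Finset.sum_le_sum fun n hn => Finset.sum_le_sum fun m hm => hb n hn m hm).trans
      (le_of_eq ?_)
    simp only [Finset.sum_add_distrib]
    congr 1
    · rw [hSdef, Finset.mul_sum]
      refine Finset.sum_congr rfl fun n hn => ?_
      rw [Finset.sum_ite_eq, if_pos hn]
    · rw [hSdef, sq S, Finset.sum_mul_sum, Finset.mul_sum]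
      exact Finset.sum_congr rfl fun n _ => (Finset.mul_sum _ _ _).symm
  set W := Q + Q ^ 2 * R * S with hW
  have hW0 : 0 < W := by positivity
  -- This `b` maximises `2 * b * (q * S / Q) - b ^ 2 * (q * S * W)`, with value `q * S / (Q ^ 2 *
  -- W)`. As `S ≥ 1`, the ratio `S / W` is bounded below, which gives the constant `η`.
  have h3 := le_measureReal_biUnion μ T hGm (1 / (Q * W))
  have hUn : (⋃ n ∈ T, G n) = codeCylinder c J ∩ ⋃ n ∈ T, appears c z n (k n) := by
    rw [inter_iUnion₂]
  rw [hUn] at h3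
  refine le_trans ?_ h3
  have h4 : 2 * (1 / (Q * W)) * (q * S / Q) - (1 / (Q * W)) ^ 2 * (q * S * W) ≤
      2 * (1 / (Q * W)) * ∑ n ∈ T, μ.real (G n) -
        (1 / (Q * W)) ^ 2 * ∑ n ∈ T, ∑ m ∈ T, μ.real (G n ∩ G m) := by
    have : ∑ n ∈ T, ∑ m ∈ T, μ.real (G n ∩ G m) ≤ q * S * W := h2.trans (le_of_eq (by rw [hW]; ring))
    gcongr
  refine le_trans ?_ h4
  have h5 : 2 * (1 / (Q * W)) * (q * S / Q) - (1 / (Q * W)) ^ 2 * (q * S * W) =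
      q * S / (Q ^ 2 * W) := by
    field_simp
    ring
  rw [h5, div_mul_eq_mul_div, one_mul, div_le_div_iff₀ (by positivity) (by positivity)]
  have h6 : W ≤ (Q + Q ^ 2 * R) * S := by
    rw [hW]
    nlinarith
  calc q * (Q ^ 2 * W) ≤ q * (Q ^ 2 * ((Q + Q ^ 2 * R) * S)) := by gcongr
    _ = _ := by ring

/-- The exceptional set `B` fills at most the fraction `1 - η` of every cylinder. Summing over the
cylinders of the approximations `D N`, which depend on finitely many letters and decrease to `B`,
gives `μ(B) ≤ (1 - η) μ(B)` in the limit. -/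
lemma measure_eq_zero_of_separated (h : IsQuasiBernoulli μ c Q) {z : ℕ → ι} {l L : ℕ}
    (hz : ∀ k, L < k → ¬ ∀ j < l, z (k + j) = z j) {k : ℕ → ℕ} (hk : ∀ n, l ≤ k n)
    {A : Set ℕ} (hAsep : ∀ n ∈ A, ∀ m ∈ A, n < m → n + L < m)
    (hA : ¬ Summable (A.indicator fun n => μ.real (codeCylinder c (pre z (k n))))) (M : ℕ) :
    μ {ω | ∀ n ∈ A, M ≤ n → ω ∉ appears c z n (k n)} = 0 := by
  obtain ⟨η, hη, hprop⟩ := h.exists_proportion hz hk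
  set B : Set Ω := {ω | ∀ n ∈ A, M ≤ n → ω ∉ appears c z n (k n)} with hB
  set D : ℕ → Set Ω := fun N => {ω | ∀ n ∈ A, M ≤ n → n ≤ N → ω ∉ appears c z n (k n)} with hD
  have hDdep : ∀ N, ∃ m, DependsOnFirst c m (D N) := by
    intro N
    refine ⟨∑ n ∈ Finset.range (N + 1), (n + k n), fun ω ω' he hω n hn hM hN hmem => ?_⟩
    refine hω n hn hM hN (((dependsOnFirst_appears c z n (k n)).mono ?_) ω' ω he.symm hmem)
    exact Finset.single_le_sum (f := fun n => n + k n) (fun _ _ => Nat.zero_le _)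
      (Finset.mem_range.2 (by omega))
  have hDm : ∀ N, MeasurableSet (D N) := fun N =>
    h.measurableSet_of_dependsOnFirst (hDdep N).choose_spec
  have hBD : B = ⋂ N, D N := by
    ext ω
    simp only [hB, hD, mem_ofPred_eq, mem_iInter]
    exact ⟨fun hω N n hn hM _ => hω n hn hM, fun hω n hn hM => hω n n hn hM le_rfl⟩
  have hBm : MeasurableSet B := hBD ▸ MeasurableSet.iInter hDm
  have hcyl : ∀ J, μ.real (codeCylinder c J ∩ B) ≤ (1 - η) * μ.real (codeCylinder c J) := by
    intro J
    obtain ⟨T, hT, hsum⟩ := exists_finset_one_le_sum (fun n => (h.pos (pre z (k n))).le) hA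
      (max M J.length)
    have h1 := hprop J T (fun n hn => (le_max_right _ _).trans (hT n hn).2)
      (fun n hn m hm => hAsep n (hT n hn).1 m (hT m hm).1) hsum
    set U := ⋃ n ∈ T, appears c z n (k n)
    have hUm : MeasurableSet U := T.measurableSet_biUnion fun n _ =>
      h.measurableSet_of_dependsOnFirst (dependsOnFirst_appears c z n (k n))
    have h2 : μ.real (codeCylinder c J ∩ B) ≤ μ.real (codeCylinder c J \ U) := by
      refine measureReal_mono ?_
      rintro ω ⟨hω1, hω2⟩
      refine ⟨hω1, fun hωU => ?_⟩
      obtain ⟨n, hn, hωn⟩ := mem_iUnion₂.1 hωU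
      exact hω2 n (hT n hn).1 ((le_max_left _ _).trans (hT n hn).2) hωn
    have h3 := measureReal_inter_add_sdiff (μ := μ) (s := codeCylinder c J) hUm
    linarith
  have hle : ∀ N, μ.real B ≤ (1 - η) * μ.real (D N) := by
    intro N
    obtain ⟨m, hm⟩ := hDdep N
    have hsub : D N ∩ B = B := inter_eq_right.2 (hBD ▸ iInter_subset D N)
    rw [← hsub, h.measureReal_inter_eq_sum hm hBm, h.measureReal_eq_sum hm, Finset.mul_sum]
    exact Finset.sum_le_sum fun I _ => hcyl _
  have hlim : Tendsto (fun N => μ.real (D N)) atTop (𝓝 (μ.real B)) := by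
    rw [hBD]
    refine (ENNReal.tendsto_toReal (measure_ne_top _ _)).comp
      (tendsto_measure_iInter_atTop (fun N => (hDm N).nullMeasurableSet) ?_
        ⟨0, measure_ne_top _ _⟩)
    exact fun N N' hNN' ω hω n hn hM hN => hω n hn hM (hN.trans hNN')
  have h1 := ge_of_tendsto' (hlim.const_mul (1 - η)) hle
  have h2 : 0 ≤ μ.real B := measureReal_nonneg
  have h3 : μ.real B = 0 := by nlinarith
  exact (measureReal_eq_zero_iff).1 h3

/-- A Borel-Cantelli lemma for shrinking cylinders around a sequence `z` one of whose initial words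
appears only finitely often in `z`: no monotonicity of the lengths is needed. -/
theorem ae_forall_exists_appears (h : IsQuasiBernoulli μ c Q) {z : ℕ → ι} {l : ℕ}
    (hz : {k : ℕ | ∀ j < l, z (k + j) = z j}.Finite) {k : ℕ → ℕ} (hk : ∀ n, l ≤ k n)
    {A : Set ℕ}
    (hA : ¬ Summable (A.indicator fun n => μ.real (codeCylinder c (pre z (k n))))) :
    ∀ᵐ ω ∂μ, ∀ M, ∃ n ∈ A, M ≤ n ∧ ω ∈ appears c z n (k n) := by
  classical
  obtain ⟨L, hL⟩ := hz.bddAbove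
  have hz' : ∀ k, L < k → ¬ ∀ j < l, z (k + j) = z j := fun k hk hj =>
    absurd (hL hj) (not_le.2 hk)
  set a : ℕ → ℝ := fun n => μ.real (codeCylinder c (pre z (k n))) with ha
  -- Distinct places in one residue class modulo `L + 1` differ by more than `L`, and some class
  -- keeps a divergent sum.
  obtain ⟨r, hr⟩ : ∃ r, ¬ Summable ({n ∈ A | n % (L + 1) = r}.indicator a) := by
    by_contra! hall
    refine hA ((summable_sum (s := Finset.range (L + 1)) fun r _ => hall r).congr fun n => ?_)
    simp only [indicator_apply, mem_ofPred_eq]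
    by_cases hn : n ∈ A
    · have := Nat.mod_lt n L.succ_pos
      simp only [hn, true_and, if_true, Finset.sum_ite_eq, Finset.mem_range, this]
    · simp [hn]
  rw [ae_all_iff]
  intro M
  have h0 := h.measure_eq_zero_of_separated hz' hk (A := {n ∈ A | n % (L + 1) = r})
    (fun n hn m hm hnm => by
      have h1 : (m - n) % (L + 1) = 0 := Nat.sub_mod_eq_zero_of_mod_eq (hm.2.trans hn.2.symm)
      have h2 := Nat.le_of_dvd (by omega) (Nat.dvd_of_mod_eq_zero h1)
      omega) hr M
  filter_upwards [measure_eq_zero_iff_ae_notMem.1 h0] with ω hω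
  by_contra hcon
  push Not at hcon
  exact hω fun n hn hM => hcon n hn.1 hM

end IsQuasiBernoulli

end Symbolic

/-! ### Full dimension of the points with a leading block coding. -/

section Dense

variable {ι E : Type*} [MetricSpace E] {φ : ι → E → E} {X : Set E} {C ρ : ℝ}

namespace IsQuasiSimilar

lemma prepend_coding (h : IsQuasiSimilar φ X C ρ) (w : List ι) {a : ℕ → ι} {y : E}
    (ha : ∀ m, y ∈ cylinder φ X (pre a m)) (m : ℕ) :
    wordMap φ w y ∈ cylinder φ X (pre (prepend w a) m) := by
  have h1 : wordMap φ w y ∈ cylinder φ X (pre (prepend w a) (w.length + m)) := by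
    rw [pre_prepend, cylinder_append]
    exact mem_image_of_mem _ (ha m)
  rw [add_comm, pre_add] at h1
  exact h.cylinder_append_subset _ _ h1

/-- A long constant word followed by blocks none of which is constant is a leading block coding. -/
lemma hasLeadingBlockCoding (h : IsQuasiSimilar φ X C ρ) {n : ℕ} (hn : 0 < n) {i₀ : ι}
    {𝒥 : Finset (Fin n → ι)} (h𝒥 : (fun _ => i₀) ∉ 𝒥) {y : E} (hy : y ∈ blockSet φ X hn 𝒥) :
    HasLeadingBlockCoding φ X (wordMap φ (List.replicate (2 * n) i₀) y) := by
  obtain ⟨b, hb⟩ := hy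
  refine ⟨prepend (List.replicate (2 * n) i₀) (concatBlocks hn b), h.prepend_coding _ hb, 2 * n,
    by omega, (finite_lt_nat (2 * n)).subset fun k hk => ?_⟩
  by_contra hlt
  have hlt' : 2 * n ≤ k := not_lt.1 hlt
  obtain ⟨k', rfl⟩ := Nat.exists_eq_add_of_le hlt'
  have hdiv := Nat.div_add_mod k' n
  have hmod := Nat.mod_lt k' hn
  refine h𝒥 ?_
  convert (b (k' / n + 1)).2
  rename_i r
  have hr := r.2
  -- A window of `2 * n` letters past the initial constant word contains the whole block number `k'
  -- / n + 1`; the offset `n - k' % n` is where it starts.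
  have h1 := hk (n - k' % n + r) (by omega)
  have h2 : 2 * n + k' + (n - k' % n + r) = 2 * n + (n * (k' / n + 1) + r) := by
    rw [mul_add]; omega
  rw [h2] at h1
  rw [← concatBlocks_apply hn b]
  simp only [prepend, List.length_replicate] at h1
  rw [dif_neg (by omega), dif_pos (by omega), Nat.add_sub_cancel_left] at h1
  simpa using h1.symm

lemma dimH_le_dimH_image (h : IsQuasiSimilar φ X C ρ) (w : List ι) {S : Set E} (hS : S ⊆ X) :
    dimH S ≤ dimH (wordMap φ w '' S) := by
  obtain ⟨g, hg, hgx⟩ := h.exists_lipschitz_inverse w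
  have himg : g '' (wordMap φ w '' S) = S := by
    rw [← image_comp]
    exact (image_congr fun x hx => hgx x (hS hx)).trans (image_id S)
  have := (hg.mono (image_mono hS)).dimH_image_le
  rwa [himg] at this

variable [Fintype ι]

lemma exists_sum_cdiam_lower (h : IsQuasiSimilar φ X C ρ) (hfin : dimH X ≠ ∞) :
    ∃ κ > 0, ∀ n, κ ≤ ∑ J : Fin n → ι, cdiam φ X (List.ofFn J) ^ (dimH X).toReal := by
  borelize E
  obtain ⟨A, hA, hcyl⟩ := h.exists_measure_cylinder hfin
  have htop := h.hausdorffMeasure_lt_top hfin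
  have hM : 0 < (Measure.hausdorffMeasure (dimH X).toReal).real X :=
    ENNReal.toReal_pos (h.hausdorffMeasure_pos hfin).ne' htop.ne
  refine ⟨(Measure.hausdorffMeasure (dimH X).toReal).real X / A, by positivity, fun n => ?_⟩
  rw [div_le_iff₀' hA, Finset.mul_sum]
  have hX := h.cylinder_eq_iUnion [] n
  rw [cylinder_nil] at hX
  simp only [List.nil_append] at hX
  calc (Measure.hausdorffMeasure (dimH X).toReal).real X
      = (Measure.hausdorffMeasure (dimH X).toReal).real
          (⋃ J : Fin n → ι, cylinder φ X (List.ofFn J)) := by rw [← hX]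
    _ ≤ ∑ J : Fin n → ι, (Measure.hausdorffMeasure (dimH X).toReal).real
          (cylinder φ X (List.ofFn J)) := measureReal_iUnion_fintype_le _
    _ ≤ _ := Finset.sum_le_sum fun J _ => (hcyl _).1

/-- Subsystems without the constant words have dimension close to that of `X`. -/
lemma exists_blocks (h : IsQuasiSimilar φ X C ρ) (hfin : dimH X ≠ ∞) (i₀ : ι) {t : ℝ}
    (ht0 : 0 < t) (hts : t < (dimH X).toReal) :
    ∃ (n : ℕ) (_ : 0 < n) (𝒥 : Finset (Fin n → ι)), (fun _ => i₀) ∉ 𝒥 ∧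
      1 ≤ ∑ J ∈ 𝒥, (cdiam φ X (List.ofFn J) / C) ^ t := by
  classical
  have hC := h.C_pos
  have hD := h.diam_pos
  obtain ⟨κ, hκ, hlow⟩ := h.exists_sum_cdiam_lower hfin
  set s := (dimH X).toReal
  have hst : 0 < s - t := sub_pos.2 hts
  have hlim : Tendsto (fun n : ℕ => (ρ ^ n * diam X) ^ (s - t) * (C ^ t + diam X ^ t)) atTop
      (𝓝 0) := by
    have h1 : Tendsto (fun n : ℕ => ρ ^ n * diam X) atTop (𝓝 0) := by
      simpa using (tendsto_pow_atTop_nhds_zero_of_lt_one h.rho_pos.le h.rho_lt).mul_const (diam X)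
    have h2 := (h1.rpow_const (p := s - t) (Or.inr hst.le)).mul_const (C ^ t + diam X ^ t)
    rwa [Real.zero_rpow hst.ne', zero_mul] at h2
  -- Since the `s`-sums stay above `κ`, the `t`-sums grow without bound. The target `C ^ t + diam X
  -- ^ t` covers the normalisation by `C` and the removed constant block.
  obtain ⟨n, hn, hn0⟩ := ((hlim.eventually_lt_const hκ).and (eventually_gt_atTop 0)).exists
  have hρ := h.rho_pos
  have hdle : ∀ J : Fin n → ι, cdiam φ X (List.ofFn J) ≤ ρ ^ n * diam X := fun J => by
    simpa using h.diam_le (List.ofFn J)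
  have hsum : C ^ t + diam X ^ t ≤ ∑ J : Fin n → ι, cdiam φ X (List.ofFn J) ^ t := by
    by_contra! hlt
    have hp : 0 < (ρ ^ n * diam X) ^ (s - t) := by positivity
    have h1 : ∑ J : Fin n → ι, cdiam φ X (List.ofFn J) ^ s ≤
        (ρ ^ n * diam X) ^ (s - t) * ∑ J : Fin n → ι, cdiam φ X (List.ofFn J) ^ t := by
      rw [Finset.mul_sum]
      refine Finset.sum_le_sum fun J _ => ?_
      have hJ := h.cdiam_pos (List.ofFn J)
      calc cdiam φ X (List.ofFn J) ^ s
          = cdiam φ X (List.ofFn J) ^ (s - t) * cdiam φ X (List.ofFn J) ^ t := by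
            rw [← Real.rpow_add hJ]; ring_nf
        _ ≤ _ := by
            gcongr
            exact hdle J
    have h2 := mul_lt_mul_of_pos_left hlt hp
    linarith [hlow n]
  refine ⟨n, hn0, Finset.univ.erase fun _ => i₀, Finset.notMem_erase _ _, ?_⟩
  have hCt : 0 < C ^ t := by positivity
  simp only [Real.div_rpow (h.cdiam_pos _).le hC.le, ← Finset.sum_div]
  rw [le_div_iff₀ hCt, one_mul]
  have h1 := Finset.add_sum_erase Finset.univ (fun J : Fin n → ι => cdiam φ X (List.ofFn J) ^ t)
    (Finset.mem_univ fun _ => i₀)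
  have h2 : cdiam φ X (List.ofFn fun _ : Fin n => i₀) ^ t ≤ diam X ^ t := by
    refine Real.rpow_le_rpow diam_nonneg ?_ ht0.le
    exact (hdle _).trans (mul_le_of_le_one_left hD.le (pow_le_one₀ hρ.le h.rho_lt.le))
  linarith

/-- The points with a leading block coding have full dimension. -/
theorem dimH_leadingBlock (h : IsQuasiSimilar φ X C ρ) (hfin : dimH X ≠ ∞) :
    dimH {z ∈ X | HasLeadingBlockCoding φ X z} = dimH X := by
  refine le_antisymm (dimH_mono fun z hz => hz.1) (ENNReal.le_of_forall_nnreal_lt fun t ht => ?_)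
  rcases eq_or_ne t 0 with rfl | ht0
  · simp
  obtain ⟨i₀⟩ := h.nonempty_index
  have hts : (t : ℝ) < (dimH X).toReal := by
    have := (ENNReal.toReal_lt_toReal ENNReal.coe_ne_top hfin).2 ht
    rwa [ENNReal.coe_toReal] at this
  have ht0' : 0 < t := pos_iff_ne_zero.2 ht0
  obtain ⟨n, hn, 𝒥, h𝒥, hsum⟩ := h.exists_blocks hfin i₀ (t := t) (by exact_mod_cast ht0') hts
  refine (h.le_dimH_blockSet hn ht0' hsum).trans
    ((h.dimH_le_dimH_image (List.replicate (2 * n) i₀) (blockSet_subset φ X hn 𝒥)).trans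
      (dimH_mono ?_))
  rintro _ ⟨y, hy, rfl⟩
  exact ⟨h.mapsTo _ (blockSet_subset φ X hn 𝒥 hy), h.hasLeadingBlockCoding hn h𝒥 hy⟩

end IsQuasiSimilar

end Dense

/-! ### From codes to approximation in `X`. -/

section Approximation

variable {ι E : Type*} [MetricSpace E] {φ : ι → E → E} {X : Set E} {C ρ : ℝ}

namespace IsQuasiSimilar

lemma codeCylinder_inter (h : IsQuasiSimilar φ X C ρ) {c : E → ℕ → ι}
    (hc : ∀ x ∈ X, ∀ n, x ∈ cylinder φ X (pre (c x) n)) (I : List ι) :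
    codeCylinder c I ∩ X = cylinder φ X I := by
  ext x
  constructor
  · rintro ⟨hx, hxX⟩
    have hx' : pre (c x) I.length = I := hx
    rw [← hx']
    exact hc x hxX _
  · exact fun hx => ⟨h.pre_eq_of_mem (hc x (h.cylinder_subset I hx)) hx, h.cylinder_subset I hx⟩

lemma measurableSet_code [Finite ι] [MeasurableSpace E] [BorelSpace E]
    (h : IsQuasiSimilar φ X C ρ) {c : E → ℕ → ι}
    (hc : ∀ x ∈ X, ∀ n, x ∈ cylinder φ X (pre (c x) n)) (hc' : ∀ x ∉ X, ∀ y ∉ X, c x = c y)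
    (n : ℕ) (i : ι) : MeasurableSet {x | c x n = i} := by
  have hX := h.isCompact.isClosed.measurableSet
  have h1 : {x | c x n = i} ∩ X = ⋃ I : Fin n → ι, cylinder φ X (List.ofFn I ++ [i]) := by
    ext x
    simp only [mem_iUnion]
    constructor
    · rintro ⟨hx, hxX⟩
      have hx' : c x n = i := hx
      have := hc x hxX (n + 1)
      rw [pre_succ, hx'] at this
      exact ⟨fun k => c x k, this⟩
    · rintro ⟨I, hI⟩
      have hxX := h.cylinder_subset _ hI
      have := h.pre_eq_of_mem (hc x hxX) hI
      rw [List.length_append, List.length_ofFn, List.length_singleton, pre_succ] at this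
      have h2 := (List.append_inj this (by simp)).2
      exact ⟨by simpa using h2, hxX⟩
  have h2 : MeasurableSet ({x | c x n = i} ∩ X) := by
    rw [h1]
    exact MeasurableSet.iUnion fun I => (h.isCompact_cylinder _).isClosed.measurableSet
  have h3 : MeasurableSet ({x | c x n = i} \ X) := by
    rcases ({x | c x n = i} \ X).eq_empty_or_nonempty with h0 | ⟨y, hy, hyX⟩
    · rw [h0]; exact MeasurableSet.empty
    · convert hX.compl using 1
      ext x
      refine ⟨fun hx => hx.2, fun hx => ⟨?_, hx⟩⟩
      have hy' : c y n = i := hy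
      change c x n = i
      rw [hc' x hx y hyX, hy']
  rw [← inter_union_sdiff {x | c x n = i} X]
  exact h2.union h3

/-- The Hausdorff measure on `X` is quasi-multiplicative. -/
theorem exists_isQuasiBernoulli [Fintype ι] [MeasurableSpace E] [BorelSpace E]
    (h : IsQuasiSimilar φ X C ρ) (hfin : dimH X ≠ ∞) {c : E → ℕ → ι}
    (hc : ∀ x ∈ X, ∀ n, x ∈ cylinder φ X (pre (c x) n)) (hc' : ∀ x ∉ X, ∀ y ∉ X, c x = c y) :
    ∃ Q, IsQuasiBernoulli ((Measure.hausdorffMeasure (dimH X).toReal).restrict X) c Q := by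
  obtain ⟨A, hA, hcyl⟩ := h.exists_measure_cylinder hfin
  have hC := h.C_pos
  set s := (dimH X).toReal
  have hs : 0 ≤ s := ENNReal.toReal_nonneg
  set μ : Measure E := Measure.hausdorffMeasure s
  have hq : ∀ I, (μ.restrict X).real (codeCylinder c I) = μ.real (cylinder φ X I) := fun I => by
    rw [measureReal_restrict_apply' h.isCompact.isClosed.measurableSet, h.codeCylinder_inter hc]
  refine ⟨max 1 (A ^ 3 * C ^ s), h.measurableSet_code hc hc', le_max_left _ _, fun I => ?_,
    fun I J => ?_, fun I J => ?_⟩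
  · rw [hq]
    have h1 : 0 < cdiam φ X I ^ s := Real.rpow_pos_of_pos (h.cdiam_pos I) s
    exact pos_of_mul_pos_right (h1.trans_le (hcyl I).2) hA.le
  · simp only [hq]
    calc μ.real (cylinder φ X (I ++ J)) ≤ A * cdiam φ X (I ++ J) ^ s := (hcyl _).1
      _ ≤ A * (C * (cdiam φ X I * cdiam φ X J)) ^ s := by
        gcongr
        exact h.cdiam_append_le I J
      _ = A * C ^ s * (cdiam φ X I ^ s * cdiam φ X J ^ s) := by
        rw [Real.mul_rpow hC.le (by positivity), Real.mul_rpow diam_nonneg diam_nonneg]; ring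
      _ ≤ A * C ^ s * ((A * μ.real (cylinder φ X I)) * (A * μ.real (cylinder φ X J))) := by
        gcongr
        exacts [(hcyl I).2, (hcyl J).2]
      _ = A ^ 3 * C ^ s * (μ.real (cylinder φ X I) * μ.real (cylinder φ X J)) := by ring
      _ ≤ _ := by
        gcongr
        exact le_max_right _ _
  · simp only [hq]
    calc μ.real (cylinder φ X I) * μ.real (cylinder φ X J)
        ≤ (A * cdiam φ X I ^ s) * (A * cdiam φ X J ^ s) := by
          gcongr
          exacts [(hcyl I).1, (hcyl J).1]
      _ = A ^ 2 * (cdiam φ X I * cdiam φ X J) ^ s := by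
        rw [Real.mul_rpow diam_nonneg diam_nonneg]; ring
      _ ≤ A ^ 2 * (C * cdiam φ X (I ++ J)) ^ s :=
        mul_le_mul_of_nonneg_left (Real.rpow_le_rpow
          (mul_nonneg diam_nonneg diam_nonneg) (h.le_cdiam_append I J) hs) (by positivity)
      _ = A ^ 2 * C ^ s * cdiam φ X (I ++ J) ^ s := by
        rw [Real.mul_rpow hC.le diam_nonneg]; ring
      _ ≤ A ^ 2 * C ^ s * (A * μ.real (cylinder φ X (I ++ J))) := by
        gcongr
        exact (hcyl _).2
      _ = A ^ 3 * C ^ s * μ.real (cylinder φ X (I ++ J)) := by ring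
      _ ≤ _ := by
        gcongr
        exact le_max_right _ _

/-- Every scale is attained by the cylinders around a sequence, up to a constant. -/
lemma exists_scale [Finite ι] (h : IsQuasiSimilar φ X C ρ) (a : ℕ → ι) (l : ℕ) :
    ∃ b > 0, ∀ ε > 0, ∃ k, l ≤ k ∧ C * cdiam φ X (pre a k) < ε ∧
      b * min ε 1 ≤ cdiam φ X (pre a k) := by
  classical
  have hC := h.C_pos
  obtain ⟨ε₁, hε₁, hε₁le⟩ := h.exists_cdiam_lower 1
  have hl := h.cdiam_pos (pre a l)
  -- The least admissible `k` is used. If `k = l`, the first constant serves, and `ε` must be capped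
  -- at `1`; if `k > l`, its predecessor fails the bound and one more letter costs at most `ε₁ / C`.
  refine ⟨min (cdiam φ X (pre a l)) (ε₁ / C ^ 2), by positivity, fun ε hε => ?_⟩
  have hex : ∃ k, l ≤ k ∧ C * cdiam φ X (pre a k) < ε := by
    obtain ⟨N, hN⟩ := h.cdiam_pre_tendsto (ε / C) (by positivity)
    refine ⟨max N l, le_max_right _ _, ?_⟩
    rw [← lt_div_iff₀' hC]
    exact hN (max N l) (le_max_left _ _) _ (by simp)
  obtain ⟨h1, h2⟩ := Nat.find_spec hex
  refine ⟨Nat.find hex, h1, h2, ?_⟩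
  rcases h1.eq_or_lt with heq | hlt
  · rw [← heq]
    calc _ ≤ cdiam φ X (pre a l) * 1 := by
          gcongr
          exacts [min_le_left _ _, min_le_right _ _]
      _ = _ := mul_one _
  · obtain ⟨k, hk⟩ : ∃ k, Nat.find hex = k + 1 := Nat.exists_eq_succ_of_ne_zero (by omega)
    have h3 := Nat.find_min hex (m := k) (by omega)
    have h4 : ε ≤ C * cdiam φ X (pre a k) := by
      by_contra! hcon
      exact h3 ⟨by omega, hcon⟩
    rw [hk, pre_succ]
    have h5 := h.le_cdiam_append (pre a k) [a k]
    have h6 := hε₁le [a k] (by simp)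
    have h7 := (h.cdiam_pos (pre a k)).le
    calc _ ≤ ε₁ / C ^ 2 * ε := by
          gcongr
          exacts [min_le_right _ _, min_le_left _ _]
      _ ≤ ε₁ / C ^ 2 * (C * cdiam φ X (pre a k)) := by gcongr
      _ = cdiam φ X (pre a k) * ε₁ / C := by field_simp
      _ ≤ cdiam φ X (pre a k) * cdiam φ X [a k] / C := by gcongr
      _ ≤ _ := by rwa [div_le_iff₀' hC]

/-- Level sums of `Diam(X_I) ^ s` are at most `C ^ s`, so `θ` alone carries the divergence. The cap
at `1` is harmless: if the capped series converged, it would eventually be uncapped. -/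
lemma not_summable_of_divergence [Fintype ι] (h : IsQuasiSimilar φ X C ρ) (hfin : dimH X ≠ ∞)
    {θ : ℕ → ℝ≥0} (hθ : DivergenceCondition φ X θ) :
    ¬ Summable fun n => min (θ (n + 1) : ℝ) 1 ^ (dimH X).toReal := by
  intro hs
  have hspos : 0 < (dimH X).toReal := ENNReal.toReal_pos h.dimH_pos.ne' hfin
  have hC := h.C_pos
  set s := (dimH X).toReal with hsdef
  have h1 : ∀ᶠ n in atTop, min (θ (n + 1) : ℝ) 1 ^ s = (θ (n + 1) : ℝ) ^ s := by
    filter_upwards [hs.tendsto_atTop_zero.eventually_lt_const one_pos] with n hn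
    rcases le_total (θ (n + 1) : ℝ) 1 with hle | hle
    · rw [min_eq_left hle]
    · rw [min_eq_right hle, Real.one_rpow] at hn
      exact absurd hn (lt_irrefl _)
  have h2 : Summable fun n => (θ (n + 1) : ℝ) ^ s := (summable_congr_atTop h1).1 hs
  have h3 := (h2.mul_left (C ^ s)).tsum_ofReal_lt_top
  refine absurd hθ (ne_of_lt (lt_of_le_of_lt (ENNReal.tsum_le_tsum fun n => ?_) h3))
  rw [← ENNReal.ofReal_sum_of_nonneg fun I _ => by positivity]
  refine ENNReal.ofReal_le_ofReal ?_
  simp only [Real.mul_rpow diam_nonneg (NNReal.coe_nonneg _), ← Finset.sum_mul]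
  gcongr
  exact h.sum_cdiam_rpow_le hfin n.succ_pos

/-- The limsup set attached to a point with a leading block coding has full measure. -/
theorem ae_mem_approxSet [Fintype ι] [MeasurableSpace E] [BorelSpace E]
    (h : IsQuasiSimilar φ X C ρ) (hfin : dimH X ≠ ∞) {z : E}
    (hz : HasLeadingBlockCoding φ X z) {θ : ℕ → ℝ≥0} (hθ : DivergenceCondition φ X θ) :
    ∀ᵐ x ∂((Measure.hausdorffMeasure (dimH X).toReal).restrict X), x ∈ approxSet φ X θ z := by
  classical
  obtain ⟨a, hacode, l, -, hl⟩ := hz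
  have hza : ∀ m, z ∈ cylinder φ X (pre a m) := hacode
  obtain ⟨c, hc, hc'⟩ := h.exists_code
  have hC := h.C_pos
  obtain ⟨Q, hQ⟩ := h.exists_isQuasiBernoulli hfin hc hc'
  obtain ⟨A₀, hA₀, hcyl⟩ := h.exists_measure_cylinder hfin
  have hdiv := h.not_summable_of_divergence hfin hθ
  have hs : 0 < (dimH X).toReal := ENNReal.toReal_pos h.dimH_pos.ne' hfin
  have hXtop := h.hausdorffMeasure_lt_top hfin
  set s := (dimH X).toReal
  set μ : Measure E := Measure.hausdorffMeasure s
  have hXm : MeasurableSet X := h.isCompact.isClosed.measurableSet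
  have hfinite : IsFiniteMeasure (μ.restrict X) := ⟨by rwa [Measure.restrict_apply_univ]⟩
  obtain ⟨b, hb, hscale⟩ := h.exists_scale a l
  have hscale' : ∀ n, ∃ k, l ≤ k ∧ (0 < θ n → C * cdiam φ X (pre a k) < θ n ∧
      b * min (θ n : ℝ) 1 ≤ cdiam φ X (pre a k)) := fun n => by
    by_cases hn : 0 < θ n
    · obtain ⟨k, hk, hk'⟩ := hscale (θ n) (by exact_mod_cast hn)
      exact ⟨k, hk, fun _ => hk'⟩
    · exact ⟨l, le_rfl, fun h0 => absurd h0 hn⟩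
  choose k hkl hk using hscale'
  -- Levels with `θ n = 0` have empty balls and add nothing to the divergent sum; `k n = l` is a
  -- dummy value there.
  set A : Set ℕ := {n | 1 ≤ n ∧ 0 < θ n} with hA
  have hq : ∀ I, (μ.restrict X).real (codeCylinder c I) = μ.real (cylinder φ X I) := fun I => by
    rw [measureReal_restrict_apply' hXm, h.codeCylinder_inter hc]
  have hns : ¬ Summable (A.indicator fun n =>
      (μ.restrict X).real (codeCylinder c (pre a (k n)))) := by
    intro hsum
    refine hdiv ((((summable_nat_add_iff 1).2 hsum).mul_left (A₀ / b ^ s)).of_nonneg_of_le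
      (fun n => by positivity) fun n => ?_)
    rcases eq_zero_or_pos (θ (n + 1)) with h0 | hpos
    · have : n + 1 ∉ A := fun hn => absurd hn.2 (by simp [h0])
      rw [indicator_of_notMem this, h0]
      simp [hs.ne']
    · have hmem : n + 1 ∈ A := ⟨by omega, hpos⟩
      rw [indicator_of_mem hmem, hq]
      have h1 := (hk (n + 1) hpos).2
      have h2 : (b * min (θ (n + 1) : ℝ) 1) ^ s ≤ cdiam φ X (pre a (k (n + 1))) ^ s :=
        Real.rpow_le_rpow (by positivity) h1 hs.le
      have h3 := h2.trans (hcyl _).2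
      rw [Real.mul_rpow hb.le (by positivity)] at h3
      have hbs : 0 < b ^ s := by positivity
      rw [div_mul_eq_mul_div, le_div_iff₀' hbs]
      exact h3
  filter_upwards [hQ.ae_forall_exists_appears hl hkl hns, ae_restrict_mem hXm] with x hx hxX
  refine ⟨hxX, ?_⟩
  set N : Set ℕ := {n | n ∈ A ∧ x ∈ appears c a n (k n)} with hN
  have hNinf : N.Infinite := infinite_of_not_bddAbove fun ⟨M, hM⟩ => by
    obtain ⟨n, hnA, hMn, hn⟩ := hx (M + 1)
    have := hM (show n ∈ N from ⟨hnA, hn⟩)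
    omega
  have hinj : InjOn (fun n => pre (c x) n) N := fun n _ m _ hnm => by
    simpa using congrArg List.length hnm
  refine (hNinf.image hinj).mono ?_
  rintro _ ⟨n, ⟨hnA, hn⟩, rfl⟩
  refine ⟨fun h0 => ?_, ?_⟩
  · have := congrArg List.length h0
    rw [length_pre] at this
    have h1 := hnA.1
    simp only [List.length_nil] at this
    omega
  · have hxn := hc x hxX (n + k n)
    -- Now `x = φ_I(y)` with `I` the first `n` letters of its code, and `y`, `z` share a cylinder of
    -- diameter below `θ n / C`.
    rw [pre_add, pre_eq_iff.2 hn, cylinder_append] at hxn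
    obtain ⟨y, hy, hyx⟩ := hxn
    change dist x (wordMap φ (pre (c x) n) z) < cdiam φ X (pre (c x) n) * θ (pre (c x) n).length
    rw [length_pre]
    have hD := h.cdiam_pos (pre (c x) n)
    calc dist x (wordMap φ (pre (c x) n) z)
        = dist (wordMap φ (pre (c x) n) y) (wordMap φ (pre (c x) n) z) := by rw [hyx]
      _ ≤ C * cdiam φ X (pre (c x) n) * dist y z :=
          h.upper _ y (h.cylinder_subset _ hy) z (h.cylinder_subset _ (hza (k n)))
      _ ≤ C * cdiam φ X (pre (c x) n) * cdiam φ X (pre a (k n)) := by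
          gcongr
          exact h.dist_le_cdiam _ hy (hza (k n))
      _ = cdiam φ X (pre (c x) n) * (C * cdiam φ X (pre a (k n))) := by ring
      _ < cdiam φ X (pre (c x) n) * θ n := by
          gcongr
          exact (hk n hnA.2).1

end IsQuasiSimilar

/-- If the attractor is a single point, no point has a leading block coding. -/
lemma not_hasLeadingBlockCoding_of_subsingleton {E : Type*} {φ : ι → E → E} {X : Set E}
    (hX : X.Subsingleton) (hXn : X.Nonempty)
    (heq : X = ⋃ i, φ i '' X) (hsep : StrongSeparation φ X) (z : E) :
    ¬ HasLeadingBlockCoding φ X z := by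
  rintro ⟨a, -, l, -, hfin⟩
  obtain ⟨x, hx⟩ := hXn
  have hι : ∀ i j : ι, i = j := fun i j => by
    by_contra hij
    have hi := mapsTo_of_eq_iUnion heq i hx
    have hj := mapsTo_of_eq_iUnion heq j hx
    refine disjoint_left.1 (hsep i j hij) (mem_image_of_mem _ hx) ?_
    rw [hX hi hj]
    exact mem_image_of_mem _ hx
  have : {k : ℕ | ∀ j < l, a (k + j) = a j} = univ := eq_univ_of_forall fun k j _ => hι _ _
  rw [this] at hfin
  exact infinite_univ hfin

end Approximation

end ConformalIFS

/-! ### The theorem. -/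

theorem mainTheorem4 {d : ℕ} {ι : Type*} [Fintype ι]
    (φ : ι → EuclideanSpace ℝ (Fin d) → EuclideanSpace ℝ (Fin d))
    (K X : Set (EuclideanSpace ℝ (Fin d)))
    (hφ : ConformalIFS.IsConformalIFS φ K)
    (hX : ConformalIFS.IsAttractor φ K X)
    (hsep : ConformalIFS.StrongSeparation φ X) :
    ∃ Y : Set (EuclideanSpace ℝ (Fin d)), Y ⊆ X ∧
      Y = {z ∈ X | ConformalIFS.HasLeadingBlockCoding φ X z} ∧
      dimH Y = dimH X ∧
      ∀ z ∈ Y, ∀ θ : ℕ → ℝ≥0, ConformalIFS.DivergenceCondition φ X θ →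
        ∀ᵐ x ∂((Measure.hausdorffMeasure (dimH X).toReal).restrict X),
          x ∈ ConformalIFS.approxSet φ X θ z := by
  refine ⟨{z ∈ X | ConformalIFS.HasLeadingBlockCoding φ X z}, fun z hz => hz.1, rfl, ?_⟩
  -- Quasi-similarity needs positive diameters. For a one-point attractor separation leaves a single
  -- letter, so `Y` is empty and both dimensions vanish.
  rcases X.subsingleton_or_nontrivial with hsub | hnt
  · refine ⟨?_, fun z hz => absurd hz.2
      (ConformalIFS.not_hasLeadingBlockCoding_of_subsingleton hsub hX.nonempty hX.eq_iUnion hsep z)⟩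
    rw [hsub.dimH_zero]
    exact (hsub.anti fun z hz => hz.1).dimH_zero
  · obtain ⟨C, ρ, h⟩ := ConformalIFS.exists_isQuasiSimilar hφ hX hsep hnt
    have hfin : dimH X ≠ ∞ := by
      refine ne_top_of_le_ne_top ?_ (dimH_mono (subset_univ X))
      rw [Real.dimH_univ_eq_finrank]
      exact ENNReal.natCast_ne_top _
    exact ⟨h.dimH_leadingBlock hfin, fun z hz θ hθ => h.ae_mem_approxSet hfin hz.2 hθ⟩
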